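/- Let $\mathbb{B}=\{0,1\mid 1+1=1\}$ be the Boolean semiring and let $\mathbb{B}\text{-}\mathsf{mod}$ be the symmetric monoidal category of $\mathbb{B}$-semimodules with the tensor product over $\mathbb{B}$. **One-foams.** $\mathsf{FCob}$ is the strict symmetric monoidal category whose objects are finite sequences of signs $+,-$ (tensor product: concatenation, unit object $\mathbf 1$: the empty sequence) and whose morphisms are generated, besides the permutation (crossing) morphisms, by a cup $\mathbf 1\to +-$, a cap $-+\to\mathbf 1$ and, for each sign $s\in\{+,-\}$, a merge vertex $ss\to s$, a split vertex $s\to ss$ and two inner endpoints $\mathbf 1\to s$ and $s\to\mathbf 1$, subject to: the axioms of a strict symmetric monoidal category; the two zigzag relations for cup and cap; the relations saying that the vertices and endpoints for $-$ are the duals, with respect to cup and cap, of those for $+$ (merge being dual to split, and $\mathbf 1\to s$ to $s'\to\mathbf 1$ for the opposite sign $s'$); associativity, commutativity and unitality of merge; coassociativity, cocommutativity and counitality of split. Optionally one also imposes that split followed by merge is the identity; the statement below holds for both versions of $\mathsf{FCob}$. **The data of a space.** Let $X$ be a finite topological space. Let $\mathcal U(X)$ be the $\mathbb{B}$-module of open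 subsets of $X$ with addition $U+V=U\cup V$, and let $X^*$ be the space with the same points whose open sets are the closed sets of $X$. For $x\in X$ let $U_x$ and $V_x$ be the smallest open and the smallest closed subset of $X$ containing $x$, and for a set $W$ let $\delta_W=1$ if $W\neq\emptyset$ and $\delta_\emptyset=0$. Put $$m(U\otimes V)=U\cap V,\qquad \Delta(U)=\sum_{x:\,U_x\subseteq U}U_x\otimes U_x,\qquad \iota(1)=X,\qquad \epsilon(U)=\delta_U$$ on $\mathcal U(X)$, define $m,\Delta,\iota,\epsilon$ on $\mathcal U(X^*)$ by the same formulas for the space $X^*$, and put $$\mathsf{coev}_X:\mathbb{B}\to\mathcal U(X)\otimes\mathcal U(X^*),\ 1\mapsto\sum_{x\in X}U_x\otimes V_x,\qquad \mathsf{ev}_X:\mathcal U(X^*)\otimes\mathcal U(X)\to\mathbb{B},\ V\otimes U\mapsto\delta_{U\cap V}.$$ **Proposition.** (1) There is a symmetric monoidal functor $\mathcal F_X:\mathsf{FCob}\to\mathbb{B}\text{-}\mathsf{mod}$ with $\mathcal F_X(+)\cong\mathcal U(X)$ and $\mathcal F_X(-)\cong\mathcal U(X^*)$ which, under these identifications,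 sends the merge vertices to $m$, the split vertices to $\Delta$, the inner endpoints $\mathbf 1\to s$ to $\iota$ and $s\to\mathbf 1$ to $\epsilon$, the cup to $\mathsf{coev}_X$ and the cap to $\mathsf{ev}_X$. (2) If $X$ is non-empty, then for every such functor $\mathcal F_X$ every closed one-foam $C\in\mathrm{End}_{\mathsf{FCob}}(\mathbf 1)$ evaluates to $1$: the endomorphism of $\mathbb{B}$ induced by $\mathcal F_X(C)$ sends $1$ to $1$. -/

import Mathlib

universe u

open CategoryTheory MonoidalCategory TopologicalSpace
open scoped TensorProduct

namespace OneFoam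

/-! ## One-foams: generators and relations -/

/-- Signs: orientations of a point. -/
inductive Sign : Type
  | plus
  | minus

open Sign

/-- Diagrams of one-foams with boundary, read from bottom to top, between sign sequences.  They are
built from the generating diagrams by vertical composition and horizontal juxtaposition.

The generators `mul`, `comul`, `unit`, `counit` at `plus` are the merge vertex, the split vertex and
the two kinds of inner endpoints on upward oriented strands; at `minus` they are the vertices and
endpoints in the same position on downward oriented strands. -/
inductive Diagram : List Sign → List Sign → Type
  /-- vertical strands; the identity of the sequence `a = b` -/
  | strands {a b : List Sign} (h : a = b) : Diagram a b
  /-- stack the second diagram on top of the first one -/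
  | comp {a b c : List Sign} (f : Diagram a b) (g : Diagram b c) : Diagram a c
  /-- put the second diagram to the right of the first one -/
  | juxt {a b c d : List Sign} (f : Diagram a b) (g : Diagram c d) : Diagram (a ++ c) (b ++ d)
  /-- the strands of `a` cross those of `c` -/
  | braid (a c : List Sign) : Diagram (a ++ c) (c ++ a)
  | cup : Diagram [] [plus, minus]
  | cap : Diagram [minus, plus] []
  | mul (s : Sign) : Diagram [s, s] [s]
  | comul (s : Sign) : Diagram [s] [s, s]
  | unit (s : Sign) : Diagram [] [s]
  | counit (s : Sign) : Diagram [s] []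

namespace Diagram

/-- The identity diagram of a sign sequence. -/
abbrev idt (a : List Sign) : Diagram a a := strands rfl

/-- The cap of the other orientation. -/
abbrev cap' : Diagram [plus, minus] [] := comp (braid [plus] [minus]) cap

end Diagram

open Diagram

/-- The relations of one-foams.  The proposition `sm` says whether the relation "split followed by
merge is the identity" is imposed. -/
inductive Rel (sm : Prop) : ∀ {a b : List Sign}, Diagram a b → Diagram a b → Prop
  -- congruence
  | refl {a b : List Sign} (f : Diagram a b) : Rel sm f f
  | symm {a b : List Sign} {f g : Diagram a b} : Rel sm f g → Rel sm g f
  | trans {a b : List Sign} {f g h : Diagram a b} : Rel sm f g → Rel sm g h → Rel sm f h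
  | comp_congr {a b c : List Sign} {f f' : Diagram a b} {g g' : Diagram b c} :
      Rel sm f f' → Rel sm g g' → Rel sm (comp f g) (comp f' g')
  | tensor_congr {a b c d : List Sign} {f f' : Diagram a b} {g g' : Diagram c d} :
      Rel sm f f' → Rel sm g g' → Rel sm (juxt f g) (juxt f' g')
  -- strict monoidal category
  | id_comp {a b : List Sign} (f : Diagram a b) : Rel sm (comp (idt a) f) f
  | comp_id {a b : List Sign} (f : Diagram a b) : Rel sm (comp f (idt b)) f
  | comp_assoc {a b c d : List Sign} (f : Diagram a b) (g : Diagram b c) (h : Diagram c d) :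
      Rel sm (comp (comp f g) h) (comp f (comp g h))
  | tensor_id (a b : List Sign) : Rel sm (juxt (idt a) (idt b)) (idt (a ++ b))
  | tensor_comp {a b c a' b' c' : List Sign} (f : Diagram a b) (g : Diagram b c)
      (f' : Diagram a' b') (g' : Diagram b' c') :
      Rel sm (comp (juxt f f') (juxt g g')) (juxt (comp f g) (comp f' g'))
  | tensor_assoc {a b c a' b' c' : List Sign} (f : Diagram a a') (g : Diagram b b')
      (h : Diagram c c') :
      Rel sm (comp (juxt (juxt f g) h) (strands (List.append_assoc a' b' c')))
        (comp (strands (List.append_assoc a b c)) (juxt f (juxt g h)))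
  | nil_tensor {a b : List Sign} (f : Diagram a b) :
      Rel sm (comp (juxt (idt []) f) (strands (List.nil_append b)))
        (comp (strands (List.nil_append a)) f)
  | tensor_nil {a b : List Sign} (f : Diagram a b) :
      Rel sm (comp (juxt f (idt [])) (strands (List.append_nil b)))
        (comp (strands (List.append_nil a)) f)
  -- symmetric structure
  | braid_natural {a b c d : List Sign} (f : Diagram a b) (g : Diagram c d) :
      Rel sm (comp (juxt f g) (braid b d)) (comp (braid a c) (juxt g f))
  | braid_symm (a b : List Sign) : Rel sm (comp (braid a b) (braid b a)) (idt (a ++ b))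
  | hexagon (a b c : List Sign) :
      Rel sm
        (comp (strands (List.append_assoc a b c))
          (comp (braid a (b ++ c)) (strands (List.append_assoc b c a))))
        (comp (juxt (braid a b) (idt c))
          (comp (strands (List.append_assoc b a c)) (juxt (idt b) (braid a c))))
  -- duality between `plus` and `minus`
  | zigzag_plus :
      Rel sm (comp (juxt cup (idt [plus]) :) (juxt (idt [plus]) cap :)) (idt [plus])
  | zigzag_minus :
      Rel sm (comp (juxt (idt [minus]) cup :) (juxt cap (idt [minus]) :)) (idt [minus])
  -- vertices and endpoints on `minus` strands are the rotations of those on `plus` strands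
  | mul_dual :
      Rel sm (comp (juxt (mul plus) (idt [minus])) cap')
        (comp (juxt (idt [plus, plus]) (comul minus) :)
          (comp (juxt (juxt (idt [plus]) cap' :) (idt [minus]) :) cap'))
  | comul_dual :
      Rel sm (comp cup (juxt (comul plus) (idt [minus])))
        (comp (comp cup (juxt (juxt (idt [plus]) cup :) (idt [minus]) :))
          (juxt (idt [plus, plus]) (mul minus) :))
  | unit_dual : Rel sm (comp (juxt (unit plus) (idt [minus])) cap') (counit minus)
  | counit_dual : Rel sm (comp (juxt (idt [plus]) (unit minus)) cap') (counit plus)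
  -- associativity, commutativity, unit and their reflections
  | mul_assoc (s : Sign) :
      Rel sm (comp (juxt (mul s) (idt [s]) :) (mul s))
        (comp (juxt (idt [s]) (mul s) :) (mul s))
  | mul_comm (s : Sign) : Rel sm (comp (braid [s] [s]) (mul s)) (mul s)
  | mul_unit (s : Sign) : Rel sm (comp (juxt (idt [s]) (unit s)) (mul s)) (idt [s])
  | comul_assoc (s : Sign) :
      Rel sm (comp (comul s) (juxt (comul s) (idt [s]) :))
        (comp (comul s) (juxt (idt [s]) (comul s) :))
  | comul_comm (s : Sign) : Rel sm (comp (comul s) (braid [s] [s])) (comul s)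
  | comul_counit (s : Sign) : Rel sm (comp (comul s) (juxt (idt [s]) (counit s))) (idt [s])
  -- optional
  | split_merge (h : sm) (s : Sign) : Rel sm (comp (comul s) (mul s)) (idt [s])

/-- Diagrams up to the relations. -/
def diagramSetoid (sm : Prop) (a b : List Sign) : Setoid (Diagram a b) where
  r := Rel sm
  iseqv := ⟨.refl, .symm, .trans⟩

/-- Objects of the category of one-foams: finite sign sequences. -/
structure FCob (sm : Prop) : Type where
  signs : List Sign

namespace FCob

variable {sm : Prop}

/-- Morphisms of the category of one-foams. -/
def Hom (A B : FCob sm) : Type := Quotient (diagramSetoid sm A.signs B.signs)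

/-- The one-foam of a diagram. -/
def Hom.mk {A B : FCob sm} (f : Diagram A.signs B.signs) : Hom A B := Quotient.mk _ f

theorem Hom.sound {A B : FCob sm} {f g : Diagram A.signs B.signs} (h : Rel sm f g) :
    (Hom.mk f : Hom A B) = Hom.mk g := Quotient.sound h

instance : Category (FCob sm) where
  Hom := Hom
  id A := Hom.mk (idt A.signs)
  comp f g := Quotient.map₂ comp (fun _ _ hf _ _ hg => Rel.comp_congr hf hg) f g
  id_comp := by rintro A B ⟨f⟩; exact Hom.sound (.id_comp f)
  comp_id := by rintro A B ⟨f⟩; exact Hom.sound (.comp_id f)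
  assoc := by rintro A B C D ⟨f⟩ ⟨g⟩ ⟨h⟩; exact Hom.sound (.comp_assoc f g h)

/-- The one-foam of a diagram, as a morphism. -/
def ofDiagram {A B : FCob sm} (f : Diagram A.signs B.signs) : A ⟶ B := Hom.mk f

theorem sound {A B : FCob sm} {f g : Diagram A.signs B.signs} (h : Rel sm f g) :
    (ofDiagram f : A ⟶ B) = ofDiagram g := Hom.sound h

theorem strands_comp {A B C : FCob sm} (h : A.signs = B.signs) (h' : B.signs = C.signs) :
    (ofDiagram (strands h) : A ⟶ B) ≫ (ofDiagram (strands h') : B ⟶ C) =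
      ofDiagram (strands (h.trans h')) := by
  obtain ⟨a⟩ := A
  obtain ⟨b⟩ := B
  obtain ⟨c⟩ := C
  cases h
  cases h'
  exact sound (.id_comp _)

/-- Equal sign sequences are isomorphic through vertical strands. -/
def strandsIso {A B : FCob sm} (h : A.signs = B.signs) : A ≅ B where
  hom := ofDiagram (strands h)
  inv := ofDiagram (strands h.symm)
  hom_inv_id := strands_comp h h.symm
  inv_hom_id := strands_comp h.symm h

/-- Juxtaposition of one-foams. -/
def tensorMap {A B C D : FCob sm} (f : A ⟶ B) (g : C ⟶ D) :
    (⟨A.signs ++ C.signs⟩ : FCob sm) ⟶ ⟨B.signs ++ D.signs⟩ :=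
  Quotient.map₂ (sc := diagramSetoid sm (A.signs ++ C.signs) (B.signs ++ D.signs))
    juxt (fun _ _ hf _ _ hg => Rel.tensor_congr hf hg) f g

instance : MonoidalCategoryStruct (FCob sm) where
  tensorObj A B := ⟨A.signs ++ B.signs⟩
  tensorUnit := ⟨[]⟩
  tensorHom := tensorMap
  whiskerLeft A _ _ f := tensorMap (𝟙 A) f
  whiskerRight f B := tensorMap f (𝟙 B)
  associator A B C := strandsIso (List.append_assoc A.signs B.signs C.signs)
  leftUnitor A := strandsIso (List.nil_append A.signs)
  rightUnitor A := strandsIso (List.append_nil A.signs)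

theorem strands_tensor {A B C D : FCob sm} (h : A.signs = B.signs) (h' : C.signs = D.signs) :
    (ofDiagram (strands h) : A ⟶ B) ⊗ₘ (ofDiagram (strands h') : C ⟶ D) =
      (ofDiagram (strands (by rw [h, h'])) :
        (⟨A.signs ++ C.signs⟩ : FCob sm) ⟶ ⟨B.signs ++ D.signs⟩) := by
  obtain ⟨a⟩ := A
  obtain ⟨b⟩ := B
  obtain ⟨c⟩ := C
  obtain ⟨d⟩ := D
  cases h
  cases h'
  exact sound (.tensor_id _ _)

instance : MonoidalCategory (FCob sm) := MonoidalCategory.ofTensorHom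
  (id_tensorHom_id := fun _ _ => sound (.tensor_id _ _))
  (id_tensorHom := fun _ _ _ _ => rfl)
  (tensorHom_id := fun _ _ => rfl)
  (tensorHom_comp_tensorHom := by
    rintro _ _ _ _ _ _ ⟨f⟩ ⟨f'⟩ ⟨g⟩ ⟨g'⟩; exact sound (.tensor_comp f g f' g'))
  (associator_naturality := by
    rintro _ _ _ _ _ _ ⟨f⟩ ⟨g⟩ ⟨h⟩; exact sound (.tensor_assoc f g h))
  (leftUnitor_naturality := by rintro _ _ ⟨f⟩; exact sound (.nil_tensor f))
  (rightUnitor_naturality := by rintro _ _ ⟨f⟩; exact sound (.tensor_nil f))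
  (pentagon := fun W X Y Z => by
    have e1 := strands_tensor (sm := sm)
      (A := ⟨(W.signs ++ X.signs) ++ Y.signs⟩) (B := ⟨W.signs ++ (X.signs ++ Y.signs)⟩)
      (C := Z) (D := Z) (List.append_assoc _ _ _) rfl
    have e2 := strands_tensor (sm := sm) (A := W) (B := W)
      (C := ⟨(X.signs ++ Y.signs) ++ Z.signs⟩) (D := ⟨X.signs ++ (Y.signs ++ Z.signs)⟩)
      rfl (List.append_assoc _ _ _)
    refine (congrArg₂ (· ≫ ·) e1 (congrArg₂ (· ≫ ·) rfl e2)).trans ?_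
    refine (congrArg (_ ≫ ·) (strands_comp _ _)).trans ?_
    exact (strands_comp _ _).trans (strands_comp _ _).symm)
  (triangle := fun X Y => by
    have e1 := strands_tensor (sm := sm) (A := X) (B := X)
      (C := ⟨[] ++ Y.signs⟩) (D := Y) rfl (List.nil_append _)
    have e2 := strands_tensor (sm := sm) (A := ⟨X.signs ++ []⟩) (B := X)
      (C := Y) (D := Y) (List.append_nil _) rfl
    refine (congrArg (_ ≫ ·) e1).trans ?_
    exact (strands_comp _ _).trans e2.symm)

/-- Crossing of two families of strands. -/
def braidIso (A B : FCob sm) : A ⊗ B ≅ B ⊗ A where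
  hom := ofDiagram (braid A.signs B.signs)
  inv := ofDiagram (braid B.signs A.signs)
  hom_inv_id := sound (.braid_symm _ _)
  inv_hom_id := sound (.braid_symm _ _)

theorem braid_hexagon (A B C : FCob sm) :
    (α_ A B C).hom ≫ (braidIso A (B ⊗ C)).hom ≫ (α_ B C A).hom =
      ((braidIso A B).hom ▷ C) ≫ (α_ B A C).hom ≫ (B ◁ (braidIso A C).hom) :=
  sound (.hexagon A.signs B.signs C.signs)

instance : SymmetricCategory (FCob sm) where
  braiding := braidIso
  braiding_naturality_right := by
    rintro A _ _ ⟨f⟩; exact sound (.braid_natural (idt A.signs) f)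
  braiding_naturality_left := by
    rintro _ _ ⟨f⟩ A; exact sound (.braid_natural f (idt A.signs))
  hexagon_forward := braid_hexagon
  hexagon_reverse A B C := by
    have h := congrArg Iso.inv (a₁ := (α_ C A B) ≪≫ braidIso C (A ⊗ B) ≪≫ (α_ A B C))
      (a₂ := whiskerRightIso (braidIso C A) B ≪≫ α_ A C B ≪≫ whiskerLeftIso A (braidIso C B))
      (Iso.ext (braid_hexagon C A B))
    simp only [Iso.trans_inv, Category.assoc] at h
    exact h
  symmetry _ _ := sound (.braid_symm _ _)

/-- The point of sign `s`. -/
def pt (s : Sign) : FCob sm := ⟨[s]⟩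

/-- The cup. -/
def cup : 𝟙_ (FCob sm) ⟶ pt plus ⊗ pt minus := ofDiagram Diagram.cup

/-- The cap. -/
def cap : (pt minus ⊗ pt plus : FCob sm) ⟶ 𝟙_ (FCob sm) := ofDiagram Diagram.cap

/-- The merge vertex. -/
def mul (s : Sign) : (pt s ⊗ pt s : FCob sm) ⟶ pt s := ofDiagram (Diagram.mul s)

/-- The split vertex. -/
def comul (s : Sign) : (pt s : FCob sm) ⟶ pt s ⊗ pt s := ofDiagram (Diagram.comul s)

/-- The inner endpoint at which a strand begins (from the bottom). -/
def unit (s : Sign) : 𝟙_ (FCob sm) ⟶ pt s := ofDiagram (Diagram.unit s)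

/-- The inner endpoint at which a strand stops. -/
def counit (s : Sign) : (pt s : FCob sm) ⟶ 𝟙_ (FCob sm) := ofDiagram (Diagram.counit s)

end FCob

/-! ## The Boolean semiring -/

/-- The Boolean semiring `{0, 1}` with `1 + 1 = 1`. -/
inductive 𝔹 : Type u
  | zero
  | one

namespace 𝔹

instance : Zero 𝔹.{u} := ⟨zero⟩
instance : One 𝔹.{u} := ⟨one⟩
instance : Add 𝔹.{u} := ⟨fun a b => match a with | zero => b | one => one⟩
instance : Mul 𝔹.{u} := ⟨fun a b => match a with | zero => zero | one => b⟩

instance : CommSemiring 𝔹.{u} where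
  add_assoc := by rintro ⟨⟩ ⟨⟩ ⟨⟩ <;> rfl
  zero_add := by rintro ⟨⟩ <;> rfl
  add_zero := by rintro ⟨⟩ <;> rfl
  add_comm := by rintro ⟨⟩ ⟨⟩ <;> rfl
  left_distrib := by rintro ⟨⟩ ⟨⟩ ⟨⟩ <;> rfl
  right_distrib := by rintro ⟨⟩ ⟨⟩ ⟨⟩ <;> rfl
  zero_mul := by rintro ⟨⟩ <;> rfl
  mul_zero := by rintro ⟨⟩ <;> rfl
  mul_assoc := by rintro ⟨⟩ ⟨⟩ ⟨⟩ <;> rfl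
  one_mul := by rintro ⟨⟩ <;> rfl
  mul_one := by rintro ⟨⟩ <;> rfl
  mul_comm := by rintro ⟨⟩ ⟨⟩ <;> rfl
  nsmul := nsmulRec
  npow := npowRec

open Classical in
/-- The truth value of a proposition in the Boolean semiring. -/
noncomputable def truth (p : Prop) : 𝔹.{u} := if p then 1 else 0

theorem add_idem (a : 𝔹.{u}) : a + a = a := by cases a <;> rfl

theorem truth_or (p q : Prop) : truth.{u} (p ∨ q) = truth p + truth q := by
  by_cases hp : p <;> by_cases hq : q <;> simp [truth, hp, hq, add_idem]

theorem truth_false : truth.{u} False = 0 := by simp [truth]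

/-- An additive map between modules over the Boolean semiring is linear. -/
def linearOfAdd {M N : Type*} [AddCommMonoid M] [AddCommMonoid N] [Module 𝔹.{u} M]
    [Module 𝔹.{u} N] (f : M → N) (h0 : f 0 = 0) (hadd : ∀ x y, f (x + y) = f x + f y) :
    M →ₗ[𝔹.{u}] N where
  toFun := f
  map_add' := hadd
  map_smul' c x := by
    cases c with
    | zero => exact (congrArg f (zero_smul 𝔹.{u} x)).trans (h0.trans (zero_smul 𝔹.{u} _).symm)
    | one => exact (congrArg f (one_smul 𝔹.{u} x)).trans (one_smul 𝔹.{u} _).symm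

end 𝔹

/-! ## Open sets of a finite space -/

/-- The `𝔹`-module of open sets of `X`, with union as addition. -/
def OpenSets (X : Type u) [TopologicalSpace X] : Type u := Opens X

namespace OpenSets

variable {X : Type u} [TopologicalSpace X]

instance : SetLike (OpenSets X) X := inferInstanceAs (SetLike (Opens X) X)

instance : Add (OpenSets X) := ⟨fun U V => (U ⊔ V : Opens X)⟩

instance : Zero (OpenSets X) := ⟨(⊥ : Opens X)⟩

instance : AddCommMonoid (OpenSets X) where
  add_assoc U V W := sup_assoc (α := Opens X) U V W
  zero_add U := bot_sup_eq (α := Opens X) U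
  add_zero U := sup_bot_eq (α := Opens X) U
  add_comm U V := sup_comm (α := Opens X) U V
  nsmul := nsmulRec

theorem mem_add {U V : OpenSets X} {x : X} : x ∈ U + V ↔ x ∈ U ∨ x ∈ V := Iff.rfl

theorem not_mem_zero (x : X) : x ∉ (0 : OpenSets X) := fun h => h

theorem ext {U V : OpenSets X} (h : ∀ x, x ∈ U ↔ x ∈ V) : U = V := SetLike.ext h

instance : Module 𝔹.{u} (OpenSets X) where
  smul c U := match c with | .zero => 0 | .one => U
  one_smul _ := rfl
  mul_smul := by rintro ⟨⟩ ⟨⟩ U <;> rfl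
  smul_zero := by rintro ⟨⟩ <;> rfl
  smul_add := by
    rintro ⟨⟩ U V
    · exact (add_zero (0 : OpenSets X)).symm
    · rfl
  add_smul := by
    rintro ⟨⟩ ⟨⟩ U
    · exact (add_zero (0 : OpenSets X)).symm
    · exact (zero_add U).symm
    · exact (add_zero U).symm
    · exact (sup_idem (α := Opens X) U).symm
  zero_smul _ := rfl

/-- Intersection of open sets. -/
def inter (U V : OpenSets X) : OpenSets X := (U ⊓ V : Opens X)

theorem mem_inter {U V : OpenSets X} {x : X} : x ∈ inter U V ↔ x ∈ U ∧ x ∈ V := Iff.rfl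

/-- The whole space as an open set. -/
def whole (X : Type u) [TopologicalSpace X] : OpenSets X := (⊤ : Opens X)

/-- The smallest open set that contains `x`. -/
def minOpen [Finite X] (x : X) : OpenSets X := (⟨nhdsKer {x}, isOpen_nhdsKer⟩ : Opens X)

theorem minOpen_subset_iff [Finite X] (x : X) (U : OpenSets X) :
    (minOpen x : Set X) ⊆ U ↔ x ∈ U := by
  refine ⟨fun h => h (subset_nhdsKer (Set.mem_singleton x)), fun h => ?_⟩
  exact nhdsKer_subset_iff_mem_nhdsSet.2
    ((U : Opens X).isOpen.mem_nhdsSet.2 (Set.singleton_subset_iff.2 h))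

/-- Multiplication: intersection of open sets. -/
def mul (X : Type u) [TopologicalSpace X] :
    OpenSets X ⊗[𝔹.{u}] OpenSets X →ₗ[𝔹.{u}] OpenSets X :=
  TensorProduct.lift
    (𝔹.linearOfAdd
      (fun U => 𝔹.linearOfAdd (fun V => inter U V)
        (ext fun x => by simp [mem_inter, not_mem_zero])
        (fun V W => ext fun x => by simp only [mem_inter, mem_add]; tauto))
      (LinearMap.ext fun V => ext fun x =>
        ⟨fun h => h.1, fun h => (not_mem_zero x h).elim⟩)
      (fun U W => LinearMap.ext fun V => ext fun x => by
        change x ∈ inter (U + W) V ↔ x ∈ inter U V + inter W V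
        simp only [mem_inter, mem_add]; tauto))

/-- The unit: the whole space. -/
def unit (X : Type u) [TopologicalSpace X] : 𝔹.{u} →ₗ[𝔹.{u}] OpenSets X :=
  LinearMap.toSpanSingleton 𝔹.{u} (OpenSets X) (whole X)

/-- The counit: `1` exactly on the nonempty open sets. -/
noncomputable def counit (X : Type u) [TopologicalSpace X] : OpenSets X →ₗ[𝔹.{u}] 𝔹.{u} :=
  𝔹.linearOfAdd (fun U => 𝔹.truth (∃ x, x ∈ U))
    (by simp [not_mem_zero, 𝔹.truth_false])
    (fun U V => by rw [← 𝔹.truth_or]; simp only [mem_add, exists_or])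

open Classical in
/-- The comultiplication: `U` goes to the sum of `U_x ⊗ U_x` over the points `x` with `U_x ⊆ U`,
where `U_x` is the smallest open set that contains `x`. -/
noncomputable def comul (X : Type u) [TopologicalSpace X] [Fintype X] :
    OpenSets X →ₗ[𝔹.{u}] OpenSets X ⊗[𝔹.{u}] OpenSets X :=
  𝔹.linearOfAdd
    (fun U => ∑ x : X with (minOpen x : Set X) ⊆ U, minOpen x ⊗ₜ[𝔹.{u}] minOpen x)
    (by simp [minOpen_subset_iff, not_mem_zero])
    (fun U V => by
      simp only [minOpen_subset_iff, mem_add, Finset.sum_filter, ← Finset.sum_add_distrib]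
      refine Finset.sum_congr rfl fun x _ => ?_
      have h : ∀ t : OpenSets X ⊗[𝔹.{u}] OpenSets X, t = t + t := fun t => by
        conv_lhs => rw [← one_smul 𝔹.{u} t, ← 𝔹.add_idem 1, add_smul, one_smul]
      by_cases hU : x ∈ U <;> by_cases hV : x ∈ V <;> simp [hU, hV, ← h])

end OpenSets

/-- The dual space of `X`: same points, and its open sets are the closed sets of `X`. -/
def DualSpace (X : Type u) : Type u := X

instance (X : Type u) [Fintype X] : Fintype (DualSpace X) := inferInstanceAs (Fintype X)

instance (X : Type u) [TopologicalSpace X] [Finite X] : TopologicalSpace (DualSpace X) where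
  IsOpen s := IsClosed (X := X) s
  isOpen_univ := isClosed_univ (X := X)
  isOpen_inter _ _ hs ht := IsClosed.inter (X := X) hs ht
  isOpen_sUnion S hS := by
    rw [Set.sUnion_eq_biUnion]
    exact (Set.toFinite (α := Set X) S).isClosed_biUnion (X := X) (f := id) hS

/-- A point of `X` as a point of the dual space. -/
def toDual {X : Type u} (x : X) : DualSpace X := x

section Duality

variable (X : Type u) [TopologicalSpace X] [Fintype X]

/-- The coevaluation: `1` goes to the sum of `U_x ⊗ V_x` over all points `x`, where `U_x` and `V_x`
are the smallest open set and the smallest closed set that contain `x`. -/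
noncomputable def coev :
    𝔹.{u} →ₗ[𝔹.{u}] OpenSets X ⊗[𝔹.{u}] OpenSets (DualSpace X) :=
  LinearMap.toSpanSingleton 𝔹.{u} _
    (∑ x : X, OpenSets.minOpen x ⊗ₜ[𝔹.{u}] OpenSets.minOpen (toDual x))

/-- The evaluation: `V ⊗ U` goes to `1` if `V` meets `U` and to `0` otherwise. -/
noncomputable def ev :
    OpenSets (DualSpace X) ⊗[𝔹.{u}] OpenSets X →ₗ[𝔹.{u}] 𝔹.{u} :=
  TensorProduct.lift
    (𝔹.linearOfAdd
      (fun V => 𝔹.linearOfAdd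
        (fun U => 𝔹.truth (∃ x : X, toDual x ∈ V ∧ x ∈ U))
        (by simp [OpenSets.not_mem_zero, 𝔹.truth_false])
        (fun U W => by
          rw [← 𝔹.truth_or]; simp only [OpenSets.mem_add, and_or_left, exists_or]))
      (LinearMap.ext fun U => by
        change 𝔹.truth (∃ x : X, toDual x ∈ (0 : OpenSets (DualSpace X)) ∧ x ∈ U)
          = 0
        simp [OpenSets.not_mem_zero, 𝔹.truth_false])
      (fun V W => LinearMap.ext fun U => by
        change 𝔹.truth (∃ x : X, toDual x ∈ V + W ∧ x ∈ U) =
          𝔹.truth (∃ x : X, toDual x ∈ V ∧ x ∈ U) +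
          𝔹.truth (∃ x : X, toDual x ∈ W ∧ x ∈ U)
        rw [← 𝔹.truth_or]; simp only [OpenSets.mem_add, or_and_right, exists_or]))

/-! ## The functor of a finite space -/

/-- The state space of a point: the open sets of `X`, or of the dual space of `X`. -/
abbrev state : Sign → SemimoduleCat.{u} 𝔹.{u}
  | plus => SemimoduleCat.of 𝔹.{u} (OpenSets X)
  | minus => SemimoduleCat.of 𝔹.{u} (OpenSets (DualSpace X))

/-- Multiplication on the state spaces. -/
def stateMul : ∀ s : Sign, state X s ⊗ state X s ⟶ state X s
  | plus => SemimoduleCat.ofHom (OpenSets.mul X)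
  | minus => SemimoduleCat.ofHom (OpenSets.mul (DualSpace X))

/-- Comultiplication on the state spaces. -/
noncomputable def stateComul : ∀ s : Sign, state X s ⟶ state X s ⊗ state X s
  | plus => SemimoduleCat.ofHom (OpenSets.comul X)
  | minus => SemimoduleCat.ofHom (OpenSets.comul (DualSpace X))

/-- Unit of the state spaces. -/
def stateUnit : ∀ s : Sign, 𝟙_ (SemimoduleCat.{u} 𝔹.{u}) ⟶ state X s
  | plus => SemimoduleCat.ofHom (OpenSets.unit X)
  | minus => SemimoduleCat.ofHom (OpenSets.unit (DualSpace X))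

/-- Counit of the state spaces. -/
noncomputable def stateCounit : ∀ s : Sign, state X s ⟶ 𝟙_ (SemimoduleCat.{u} 𝔹.{u})
  | plus => SemimoduleCat.ofHom (OpenSets.counit X)
  | minus => SemimoduleCat.ofHom (OpenSets.counit (DualSpace X))

/-- The cup of the state spaces. -/
noncomputable def stateCup :
    𝟙_ (SemimoduleCat.{u} 𝔹.{u}) ⟶ state X plus ⊗ state X minus :=
  SemimoduleCat.ofHom (coev X)

/-- The cap of the state spaces. -/
noncomputable def stateCap :
    state X minus ⊗ state X plus ⟶ 𝟙_ (SemimoduleCat.{u} 𝔹.{u}) :=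
  SemimoduleCat.ofHom (ev X)

end Duality

open Functor.LaxMonoidal Functor.OplaxMonoidal

/-- A symmetric monoidal functor from one-foams to `𝔹`-modules with the values on generating objects
and generating morphisms that are prescribed by the finite space `X`. -/
structure FoamFunctor (sm : Prop) (X : Type u) [TopologicalSpace X] [Fintype X] where
  functor : FCob sm ⥤ SemimoduleCat.{u} 𝔹.{u}
  [braided : functor.Braided]
  ptIso (s : Sign) : functor.obj (FCob.pt s) ≅ state X s
  map_mul (s : Sign) :
    μ functor (FCob.pt s) (FCob.pt s) ≫ functor.map (FCob.mul s) ≫ (ptIso s).hom =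
      ((ptIso s).hom ⊗ₘ (ptIso s).hom) ≫ stateMul X s
  map_comul (s : Sign) :
    functor.map (FCob.comul s) ≫ δ functor (FCob.pt s) (FCob.pt s) ≫
        ((ptIso s).hom ⊗ₘ (ptIso s).hom) =
      (ptIso s).hom ≫ stateComul X s
  map_unit (s : Sign) :
    ε functor ≫ functor.map (FCob.unit s) ≫ (ptIso s).hom = stateUnit X s
  map_counit (s : Sign) :
    functor.map (FCob.counit s) ≫ η functor = (ptIso s).hom ≫ stateCounit X s
  map_cup :
    ε functor ≫ functor.map FCob.cup ≫ δ functor (FCob.pt plus) (FCob.pt minus) ≫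
        ((ptIso plus).hom ⊗ₘ (ptIso minus).hom) =
      stateCup X
  map_cap :
    μ functor (FCob.pt minus) (FCob.pt plus) ≫ functor.map FCob.cap ≫ η functor =
      ((ptIso minus).hom ⊗ₘ (ptIso plus).hom) ≫ stateCap X

attribute [instance] FoamFunctor.braided

/-- The value of a closed one-foam: the image of `1` under the induced endomorphism of `𝔹`. -/
def FoamFunctor.eval {sm : Prop} {X : Type u} [TopologicalSpace X] [Fintype X]
    (F : FoamFunctor sm X) (C : 𝟙_ (FCob sm) ⟶ 𝟙_ (FCob sm)) : 𝔹.{u} :=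
  (ε F.functor ≫ F.functor.map C ≫ η F.functor).hom (1 : 𝔹.{u})

end OneFoam

/-! Existence. A symmetric monoidal functor out of one-foams amounts to values for the generators
that satisfy the relations. A sign sequence goes to the right-nested tensor product of its state
spaces. The relations of the symmetric monoidal structure then follow from coherence in any
symmetric monoidal category, and only the relations between generators involve `X`.

Three facts about a finite space give those relations. Every open set is the union of the `U_x` over
its points `x` (`sum_nbhd`). A point `y` lies in `V_x` exactly when `x` lies in `U_y`
(`mem_nbhd_minus_iff`). Hence pairing with `V_x` tests membership of `x`
(`exists_mem_nbhd_minus_iff`), and dually for `U_x`. The zigzags become the first fact, and most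
other relations reduce to statements about points. Where two sums of pure tensors differ as sums,
namely for coassociativity and for the duality of split and merge, they are compared in the order `a
+ b = b` (`Absorbs`). There sums are joins and tensoring is monotone, so superfluous summands are
absorbed.

Closed foams. Fix a point `x`. The functional "contains `x`" on each state space extends to a
product functional on the value of every sign sequence. No generator can turn the value `1` of this
functional into `0`: intersections keep `x`, and the sums defining `Δ` and `coev` contain the
summand at `x`. The property passes to composites, juxtapositions and crossings
(`pointFunctional_le`). On the empty sequence the functional is the identification with `𝔹`, so a
closed foam sends `1` to `1`. This uses only the prescribed values on generators, hence covers every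
functor with those values. -/

namespace OneFoam

open Sign Functor.LaxMonoidal Functor.OplaxMonoidal

/-! ### Tensor products along sign sequences and their coherence -/

section Coherence

universe v w

variable {C : Type w} [Category.{v} C] [MonoidalCategory C] (S : Sign → C)

/-- The right-nested tensor product of the objects attached to a sign sequence. -/
def listObj : List Sign → C
  | [] => 𝟙_ C
  | s :: l => S s ⊗ listObj l

/-- The tensor product of two sequences is the tensor product of the concatenated sequence. -/
def appendIso : ∀ a b : List Sign, listObj S a ⊗ listObj S b ≅ listObj S (a ++ b)
  | [], b => λ_ (listObj S b)
  | s :: a, b => α_ (S s) (listObj S a) (listObj S b) ≪≫ whiskerLeftIso (S s) (appendIso a b)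

/-- Inductions over sign sequences need the transport to act on the tail only, where the induction
hypothesis speaks about it. -/
theorem listObj_eqToHom_cons (s : Sign) {a b : List Sign} (h : a = b)
    (h' : listObj S (s :: a) = listObj S (s :: b)) :
    eqToHom h' = S s ◁ eqToHom (congrArg (listObj S) h) := by
  cases h
  exact (whiskerLeft_id _ _).symm

/-- For an empty first sequence this is unitor coherence. Prepending a sign adds one associator to
each tensorator, and the pentagon together with naturality reconciles them. It is the associativity
axiom of the monoidal functor, and it lets transports be exchanged for associators. -/
theorem appendIso_assoc (a b c : List Sign) :
    (appendIso S a b).hom ▷ listObj S c ≫ (appendIso S (a ++ b) c).hom ≫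
        eqToHom (congrArg (listObj S) (List.append_assoc a b c)) =
      (α_ _ _ _).hom ≫ listObj S a ◁ (appendIso S b c).hom ≫ (appendIso S a (b ++ c)).hom := by
  induction a with
  | nil =>
    change (λ_ (listObj S b)).hom ▷ listObj S c ≫ (appendIso S b c).hom ≫ 𝟙 _ =
      (α_ (𝟙_ C) _ _).hom ≫ 𝟙_ C ◁ (appendIso S b c).hom ≫ (λ_ (listObj S (b ++ c))).hom
    simp
  | cons s a ih =>
    have e := listObj_eqToHom_cons S s (List.append_assoc a b c)
      (congrArg (listObj S) (List.append_assoc (s :: a) b c))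
    refine (congrArg (fun t => (appendIso S (s :: a) b).hom ▷ listObj S c ≫
      (appendIso S (s :: (a ++ b)) c).hom ≫ t) e).trans ?_
    change ((α_ (S s) (listObj S a) (listObj S b)).hom ≫ S s ◁ (appendIso S a b).hom) ▷ _ ≫
      ((α_ (S s) (listObj S (a ++ b)) (listObj S c)).hom ≫ S s ◁ (appendIso S (a ++ b) c).hom) ≫ _ =
      (α_ (S s ⊗ listObj S a) _ _).hom ≫ (S s ⊗ listObj S a) ◁ (appendIso S b c).hom ≫
        (α_ (S s) (listObj S a) _).hom ≫ S s ◁ (appendIso S a (b ++ c)).hom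
    have ih' := congrArg (S s ◁ ·) ih
    simp only [whiskerLeft_comp] at ih'
    simp only [comp_whiskerRight, Category.assoc, tensor_whiskerLeft, Iso.inv_hom_id_assoc]
    rw [associator_naturality_middle_assoc, ih', pentagon_assoc]

/-- The right unit axiom needs an induction because the tensorator recurses on the left sequence;
the base case is the agreement of the two unitors at the unit object. -/
theorem appendIso_nil (a : List Sign) :
    (appendIso S a []).hom ≫ eqToHom (congrArg (listObj S) (List.append_nil a)) =
      (ρ_ (listObj S a)).hom := by
  induction a with
  | nil =>
    change (λ_ (𝟙_ C)).hom ≫ 𝟙 _ = (ρ_ (𝟙_ C)).hom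
    rw [Category.comp_id, unitors_equal]
  | cons s a ih =>
    have e := listObj_eqToHom_cons S s (List.append_nil a)
      (congrArg (listObj S) (List.append_nil (s :: a)))
    refine (congrArg (fun t => (appendIso S (s :: a) []).hom ≫ t) e).trans ?_
    change ((α_ (S s) (listObj S a) (𝟙_ C)).hom ≫ S s ◁ (appendIso S a []).hom) ≫ _ =
      (ρ_ (S s ⊗ listObj S a)).hom
    rw [rightUnitor_tensor_hom, Category.assoc]
    refine congrArg ((α_ _ _ _).hom ≫ ·) ?_
    exact (whiskerLeft_comp _ _ _).symm.trans (congrArg (S s ◁ ·) ih)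

/-- Values of the generating one-foams in a symmetric monoidal category. -/
structure Generators where
  cup : 𝟙_ C ⟶ S plus ⊗ S minus
  cap : S minus ⊗ S plus ⟶ 𝟙_ C
  mul (s : Sign) : S s ⊗ S s ⟶ S s
  comul (s : Sign) : S s ⟶ S s ⊗ S s
  unit (s : Sign) : 𝟙_ C ⟶ S s
  counit (s : Sign) : S s ⟶ 𝟙_ C

variable {S}

variable (S) in
/-- The value of a sequence of length one. -/
def pointIso (s : Sign) : listObj S [s] ≅ S s := ρ_ (S s)

variable (S) in
/-- The value of a sequence of length two. -/
def pairIso (s s' : Sign) : listObj S [s, s'] ≅ S s ⊗ S s' := whiskerLeftIso (S s) (ρ_ (S s'))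

variable (S) in
/-- The tensorator of two sequences of length one. -/
def appendPointIso (s s' : Sign) : listObj S [s] ⊗ listObj S [s'] ≅ listObj S [s, s'] :=
  appendIso S [s] [s']

/-- Values of sequences carry a trailing unit object, whereas generators are prescribed on plain
tensor products. This coherence identity makes the two ways of removing the units agree. -/
theorem appendPointIso_hom_comp (s s' : Sign) :
    (appendPointIso S s s').hom ≫ (pairIso S s s').hom =
      (pointIso S s).hom ⊗ₘ (pointIso S s').hom := by
  change ((α_ (S s) (𝟙_ C) (S s' ⊗ 𝟙_ C)).hom ≫ S s ◁ (λ_ (S s' ⊗ 𝟙_ C)).hom) ≫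
    S s ◁ (ρ_ (S s')).hom = (ρ_ (S s)).hom ⊗ₘ (ρ_ (S s')).hom
  monoidal

theorem appendPointIso_inv_comp (s s' : Sign) :
    (appendPointIso S s s').inv ≫ ((pointIso S s).hom ⊗ₘ (pointIso S s').hom) =
      (pairIso S s s').hom := by
  rw [← appendPointIso_hom_comp, Iso.inv_hom_id_assoc]

/-- Juxtaposition of morphisms between the tensor products of sequences. -/
def juxtHom {a b c d : List Sign} (f : listObj S a ⟶ listObj S b)
    (g : listObj S c ⟶ listObj S d) : listObj S (a ++ c) ⟶ listObj S (b ++ d) :=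
  (appendIso S a c).inv ≫ (f ⊗ₘ g) ≫ (appendIso S b d).hom

theorem juxtHom_id (a b : List Sign) :
    juxtHom (𝟙 (listObj S a)) (𝟙 (listObj S b)) = 𝟙 (listObj S (a ++ b)) := by
  simp [juxtHom]

theorem juxtHom_comp {a b c a' b' c' : List Sign} (f : listObj S a ⟶ listObj S b)
    (g : listObj S b ⟶ listObj S c) (f' : listObj S a' ⟶ listObj S b')
    (g' : listObj S b' ⟶ listObj S c') :
    juxtHom f f' ≫ juxtHom g g' = juxtHom (f ≫ g) (f' ≫ g') := by
  simp [juxtHom]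

theorem juxtHom_assoc {a b c a' b' c' : List Sign} (f : listObj S a ⟶ listObj S a')
    (g : listObj S b ⟶ listObj S b') (h : listObj S c ⟶ listObj S c') :
    juxtHom (juxtHom f g) h ≫ eqToHom (congrArg (listObj S) (List.append_assoc a' b' c')) =
      eqToHom (congrArg (listObj S) (List.append_assoc a b c)) ≫ juxtHom f (juxtHom g h) := by
  -- Precomposing with tensorators moves the equation to a threefold tensor product, where
  -- `appendIso_assoc` turns both transports into associators and naturality of the associator
  -- finishes.
  rw [← cancel_epi (appendIso S (a ++ b) c).hom,
    ← cancel_epi ((appendIso S a b).hom ▷ listObj S c)]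
  have h1 := appendIso_assoc S a b c
  have h2 := appendIso_assoc S a' b' c'
  calc _ = ((f ⊗ₘ g) ⊗ₘ h) ≫ ((appendIso S a' b').hom ▷ listObj S c' ≫
          (appendIso S (a' ++ b') c').hom ≫
          eqToHom (congrArg (listObj S) (List.append_assoc a' b' c'))) := by
        simp only [juxtHom, Category.assoc, Iso.hom_inv_id_assoc]
        rw [← tensorHom_id, ← tensorHom_id, tensorHom_comp_tensorHom_assoc,
          tensorHom_comp_tensorHom_assoc]
        simp
    _ = ((α_ _ _ _).hom ≫ listObj S a ◁ (appendIso S b c).hom ≫ (appendIso S a (b ++ c)).hom) ≫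
          juxtHom f (juxtHom g h) := by
        rw [h2, associator_naturality_assoc]
        simp only [juxtHom, Category.assoc, Iso.hom_inv_id_assoc]
        rw [← id_tensorHom, ← id_tensorHom, tensorHom_comp_tensorHom_assoc,
          tensorHom_comp_tensorHom_assoc]
        simp
    _ = _ := by rw [← h1]; simp only [Category.assoc]

theorem nil_juxtHom {a b : List Sign} (f : listObj S a ⟶ listObj S b) :
    juxtHom (𝟙 (listObj S [])) f = f := by
  change (λ_ (listObj S a)).inv ≫ (𝟙 (𝟙_ C) ⊗ₘ f) ≫ (λ_ (listObj S b)).hom = f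
  simp

theorem juxtHom_nil {a b : List Sign} (f : listObj S a ⟶ listObj S b) :
    juxtHom f (𝟙 (listObj S [])) ≫ eqToHom (congrArg (listObj S) (List.append_nil b)) =
      eqToHom (congrArg (listObj S) (List.append_nil a)) ≫ f := by
  rw [← cancel_epi (appendIso S a []).hom]
  simp only [juxtHom, Category.assoc, Iso.hom_inv_id_assoc]
  rw [appendIso_nil, ← Category.assoc, appendIso_nil]
  change (f ⊗ₘ 𝟙 (𝟙_ C)) ≫ _ = _
  rw [tensorHom_id]
  exact rightUnitor_naturality f

variable [SymmetricCategory C]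

/-- The crossing of two sequences. -/
abbrev braidHom (S : Sign → C) (a c : List Sign) : listObj S (a ++ c) ⟶ listObj S (c ++ a) :=
  (appendIso S a c).inv ≫ (β_ _ _).hom ≫ (appendIso S c a).hom

theorem braidHom_natural {a b c d : List Sign} (f : listObj S a ⟶ listObj S b)
    (g : listObj S c ⟶ listObj S d) :
    juxtHom f g ≫ braidHom S b d = braidHom S a c ≫ juxtHom g f := by
  simp [juxtHom, braidHom]

theorem braidHom_symm (a b : List Sign) :
    braidHom S a b ≫ braidHom S b a = 𝟙 _ := by
  simp [braidHom]

theorem braidHom_hexagon (a b c : List Sign) :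
    eqToHom (congrArg (listObj S) (List.append_assoc a b c)) ≫
        braidHom S a (b ++ c) ≫ eqToHom (congrArg (listObj S) (List.append_assoc b c a)) =
      juxtHom (braidHom S a b) (𝟙 (listObj S c)) ≫
        eqToHom (congrArg (listObj S) (List.append_assoc b a c)) ≫
          juxtHom (𝟙 (listObj S b)) (braidHom S a c) := by
  -- After the same change of source, the three transports become associators and the claim is the
  -- hexagon of `C`.
  rw [← cancel_epi (appendIso S (a ++ b) c).hom,
    ← cancel_epi ((appendIso S a b).hom ▷ listObj S c)]
  have h1 := appendIso_assoc S a b c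
  have h2 := appendIso_assoc S b c a
  have h3 := appendIso_assoc S b a c
  calc _ = ((appendIso S a b).hom ▷ listObj S c ≫ (appendIso S (a ++ b) c).hom ≫
        eqToHom (congrArg (listObj S) (List.append_assoc a b c))) ≫
        braidHom S a (b ++ c) ≫ eqToHom (congrArg (listObj S) (List.append_assoc b c a)) := by
        simp only [Category.assoc]
    _ = (α_ _ _ _).hom ≫ (β_ _ _).hom ≫ ((appendIso S b c).hom ▷ listObj S a ≫
          (appendIso S (b ++ c) a).hom ≫
          eqToHom (congrArg (listObj S) (List.append_assoc b c a))) := by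
        rw [h1]
        simp only [braidHom, Category.assoc, Iso.hom_inv_id_assoc,
          BraidedCategory.braiding_naturality_right_assoc]
    _ = (β_ _ _).hom ▷ _ ≫ ((appendIso S b a).hom ▷ listObj S c ≫ (appendIso S (b ++ a) c).hom ≫
          eqToHom (congrArg (listObj S) (List.append_assoc b a c))) ≫
            juxtHom (𝟙 (listObj S b)) (braidHom S a c) := by
        rw [h2, h3, BraidedCategory.hexagon_forward_assoc]
        simp [juxtHom, braidHom]
    _ = _ := by
        simp [juxtHom, braidHom]

/-- The value of a diagram. -/
def Generators.eval {S : Sign → C} (G : Generators S) :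
    ∀ {a b : List Sign}, Diagram a b → (listObj S a ⟶ listObj S b)
  | _, _, .strands h => eqToHom (congrArg (listObj S) h)
  | _, _, .comp f g => eval G f ≫ eval G g
  | _, _, .juxt f g => juxtHom (eval G f) (eval G g)
  | _, _, .braid a c => braidHom S a c
  | _, _, .cup => G.cup ≫ (pairIso S plus minus).inv
  | _, _, .cap => (pairIso S minus plus).hom ≫ G.cap
  | _, _, .mul s => (pairIso S s s).hom ≫ G.mul s ≫ (pointIso S s).inv
  | _, _, .comul s => (pointIso S s).hom ≫ G.comul s ≫ (pairIso S s s).inv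
  | _, _, .unit s => G.unit s ≫ (pointIso S s).inv
  | _, _, .counit s => (pointIso S s).hom ≫ G.counit s

end Coherence

/-! ### Product functionals on the values of a monoidal functor -/

section Point

universe v w

variable {C : Type w} [Category.{v} C] [MonoidalCategory C]

/-- The tensor product of two functionals. -/
abbrev tensorFunctional {M N : C} (p : M ⟶ 𝟙_ C) (q : N ⟶ 𝟙_ C) : M ⊗ N ⟶ 𝟙_ C :=
  (p ⊗ₘ q) ≫ (λ_ (𝟙_ C)).hom

theorem tensorFunctional_assoc {X Y Z : C} (p : X ⟶ 𝟙_ C) (q : Y ⟶ 𝟙_ C) (r : Z ⟶ 𝟙_ C) :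
    tensorFunctional (tensorFunctional p q) r =
      (α_ X Y Z).hom ≫ tensorFunctional p (tensorFunctional q r) := by
  have h : (λ_ (𝟙_ C)).hom ▷ 𝟙_ C ≫ (λ_ (𝟙_ C)).hom =
      (α_ (𝟙_ C) (𝟙_ C) (𝟙_ C)).hom ≫ 𝟙_ C ◁ (λ_ (𝟙_ C)).hom ≫ (λ_ (𝟙_ C)).hom := by
    monoidal
  calc _ = ((p ⊗ₘ q) ⊗ₘ r) ≫ (λ_ (𝟙_ C)).hom ▷ 𝟙_ C ≫ (λ_ (𝟙_ C)).hom := by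
        rw [← tensorHom_id, tensorHom_comp_tensorHom_assoc, Category.comp_id]
    _ = _ := by
        rw [h, associator_naturality_assoc, ← id_tensorHom, tensorHom_comp_tensorHom_assoc,
          Category.comp_id]

/-- The maps `d₁`, `d₂`, `e₁`, `e₂` stand for the maps `δ` of an oplax functor and `h` for their
coassociativity. Abstract objects are used so that sign sequences equal only by computation can be
substituted. -/
theorem comp_tensorFunctional_assoc {X Y Z U V W : C} (d₁ : W ⟶ X ⊗ V) (d₂ : V ⟶ Y ⊗ Z)
    (e₁ : W ⟶ U ⊗ Z) (e₂ : U ⟶ X ⊗ Y)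
    (h : e₁ ≫ e₂ ▷ Z ≫ (α_ X Y Z).hom = d₁ ≫ X ◁ d₂)
    (p : X ⟶ 𝟙_ C) (q : Y ⟶ 𝟙_ C) (r : Z ⟶ 𝟙_ C) :
    d₁ ≫ tensorFunctional p (d₂ ≫ tensorFunctional q r) =
      e₁ ≫ tensorFunctional (e₂ ≫ tensorFunctional p q) r := by
  have h₁ : tensorFunctional p (d₂ ≫ tensorFunctional q r) =
      X ◁ d₂ ≫ tensorFunctional p (tensorFunctional q r) := by
    simp only [tensorFunctional]
    rw [← id_tensorHom, tensorHom_comp_tensorHom_assoc, Category.id_comp]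
  have h₂ : tensorFunctional (e₂ ≫ tensorFunctional p q) r =
      e₂ ▷ Z ≫ tensorFunctional (tensorFunctional p q) r := by
    simp only [tensorFunctional]
    rw [← tensorHom_id, tensorHom_comp_tensorHom_assoc, Category.id_comp]
  rw [h₁, h₂, tensorFunctional_assoc, reassoc_of% h]

variable {sm : Prop} (F : FCob sm ⥤ C) [F.Monoidal] (q : ∀ s, F.obj (FCob.pt s) ⟶ 𝟙_ C)

/-- The tensor product of functionals on the values of a monoidal functor at points. -/
def listFunctional : ∀ a : List Sign, F.obj ⟨a⟩ ⟶ 𝟙_ C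
  | [] => η F
  | s :: a => δ F (FCob.pt s) ⟨a⟩ ≫ tensorFunctional (q s) (listFunctional a)

theorem listFunctional_singleton (s : Sign) : listFunctional F q [s] = q s := by
  change δ F (FCob.pt s) (𝟙_ (FCob sm)) ≫ (q s ⊗ₘ η F) ≫ (λ_ (𝟙_ C)).hom = q s
  have h := right_unitality_hom F (FCob.pt s)
  -- The sequences `[s] ++ []` and `[s]` agree by computation, so the unitor is an identity diagram.
  have h2 : (F.map (ρ_ (FCob.pt s : FCob sm)).hom) = 𝟙 (F.obj (FCob.pt s)) := F.map_id (FCob.pt s)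
  replace h := h.trans h2
  rw [tensorHom_def', Category.assoc, unitors_equal, rightUnitor_naturality]
  have h3 := congrArg (· ≫ q s) h
  refine Eq.trans ?_ (h3.trans (Category.id_comp (q s)))
  simp only [Category.assoc]

/-- Coassociativity and counitality of `δ` make the product functional independent of where the
sequence is cut; this is what handles juxtapositions and crossings. -/
theorem listFunctional_append (a b : List Sign) :
    listFunctional F q (a ++ b) =
      δ F ⟨a⟩ ⟨b⟩ ≫ tensorFunctional (listFunctional F q a) (listFunctional F q b) := by
  induction a with
  | nil =>
    change listFunctional F q b = δ F (𝟙_ (FCob sm)) ⟨b⟩ ≫ (η F ⊗ₘ _) ≫ (λ_ (𝟙_ C)).hom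
    have h := left_unitality_hom F (⟨b⟩ : FCob sm)
    have h2 : (F.map (λ_ (⟨b⟩ : FCob sm)).hom) = 𝟙 (F.obj ⟨b⟩) := F.map_id ⟨b⟩
    replace h := h.trans h2
    rw [MonoidalCategory.tensorHom_def, Category.assoc, leftUnitor_naturality]
    have h3 := congrArg (· ≫ listFunctional F q b) h
    refine (h3.trans (Category.id_comp (listFunctional F q b))).symm.trans ?_
    simp only [Category.assoc]
  | cons s a ih =>
    have h := Functor.OplaxMonoidal.associativity F (FCob.pt s) (⟨a⟩ : FCob sm) ⟨b⟩
    -- The first sequence has length one, so both bracketings agree by computation and the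
    -- associator is an identity diagram.
    have h2 : (F.map (α_ (FCob.pt s) (⟨a⟩ : FCob sm) ⟨b⟩).hom) = 𝟙 (F.obj ⟨s :: (a ++ b)⟩) :=
      F.map_id ⟨s :: (a ++ b)⟩
    refine (congrArg (fun t => δ F (FCob.pt s) (⟨a ++ b⟩ : FCob sm) ≫
      tensorFunctional (q s) t) ih).trans ?_
    exact comp_tensorFunctional_assoc _ _ _ _
      ((h.trans (congrArg (· ≫ _) h2)).trans (Category.id_comp _)) _ _ _

end Point

/-! ### Boolean arithmetic and functionals -/

section Evaluation

theorem 𝔹.eq_zero_or_one (a : 𝔹.{u}) : a = 0 ∨ a = 1 := by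
  cases a
  · exact .inl rfl
  · exact .inr rfl

theorem 𝔹.add_eq_one {a b : 𝔹.{u}} : a + b = 1 ↔ a = 1 ∨ b = 1 := by
  have h : (0 : 𝔹.{u}) ≠ 1 := nofun
  rcases 𝔹.eq_zero_or_one a with rfl | rfl <;> rcases 𝔹.eq_zero_or_one b with rfl | rfl <;>
    simp [h, 𝔹.add_idem]

theorem 𝔹.mul_eq_one {a b : 𝔹.{u}} : a * b = 1 ↔ a = 1 ∧ b = 1 := by
  have h : (0 : 𝔹.{u}) ≠ 1 := nofun
  rcases 𝔹.eq_zero_or_one a with rfl | rfl <;> rcases 𝔹.eq_zero_or_one b with rfl | rfl <;>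
    simp [h]

theorem 𝔹.truth_eq_one {p : Prop} : 𝔹.truth.{u} p = 1 ↔ p := by
  have h : (0 : 𝔹.{u}) ≠ 1 := nofun
  by_cases hp : p <;> simp [𝔹.truth, hp, h]

theorem 𝔹.sum_eq_one {ι : Type*} {s : Finset ι} {f : ι → 𝔹.{u}} :
    ∑ i ∈ s, f i = 1 ↔ ∃ i ∈ s, f i = 1 := by
  classical
  have h : (0 : 𝔹.{u}) ≠ 1 := nofun
  induction s using Finset.induction_on with
  | empty => simp [h]
  | insert i s hi ih => simp [Finset.sum_insert hi, 𝔹.add_eq_one, ih]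

/-- The functional that tests whether an open set contains a given point. -/
noncomputable def OpenSets.memFunctional {X : Type u} [TopologicalSpace X] (x : X) :
    OpenSets X →ₗ[𝔹.{u}] 𝔹.{u} :=
  𝔹.linearOfAdd (fun U => 𝔹.truth (x ∈ U)) (by simp [OpenSets.not_mem_zero, 𝔹.truth_false])
    (fun U V => by rw [← 𝔹.truth_or]; rfl)

theorem OpenSets.memFunctional_eq_one {X : Type u} [TopologicalSpace X] {x : X} {U : OpenSets X} :
    OpenSets.memFunctional x U = 1 ↔ x ∈ U := 𝔹.truth_eq_one

variable {M N : SemimoduleCat.{u} 𝔹.{u}}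

theorem tensorFunctional_tmul_eq_one {p : M ⟶ 𝟙_ (SemimoduleCat.{u} 𝔹.{u})} {q : N ⟶ 𝟙_ _}
    {x : M} {y : N} :
    (tensorFunctional p q).hom (x ⊗ₜ[𝔹.{u}] y) = (1 : 𝔹.{u}) ↔
      p.hom x = (1 : 𝔹.{u}) ∧ q.hom y = (1 : 𝔹.{u}) := 𝔹.mul_eq_one

/-- To bound a functional on a tensor product from below it is enough to do so on pure tensors. -/
theorem functional_le_of_tmul {p q : M ⊗ N ⟶ 𝟙_ (SemimoduleCat.{u} 𝔹.{u})}
    (h : ∀ (x : M) (y : N), p.hom (x ⊗ₜ[𝔹.{u}] y) = (1 : 𝔹.{u}) →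
      q.hom (x ⊗ₜ[𝔹.{u}] y) = (1 : 𝔹.{u}))
    (t : (M ⊗ N : SemimoduleCat.{u} 𝔹.{u})) (ht : p.hom t = (1 : 𝔹.{u})) :
    q.hom t = (1 : 𝔹.{u}) := by
  induction t using TensorProduct.induction_on with
  | zero => exact absurd ((map_zero p.hom).symm.trans ht) nofun
  | tmul x y => exact h x y ht
  | add x y hx hy =>
    refine (map_add q.hom x y).trans (𝔹.add_eq_one.2 ?_)
    exact (𝔹.add_eq_one.1 ((map_add p.hom x y).symm.trans ht)).imp hx hy

end Evaluation

theorem OpenSets.mem_minOpen_self {X : Type u} [TopologicalSpace X] [Finite X] (x : X) :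
    x ∈ OpenSets.minOpen x := (OpenSets.minOpen_subset_iff x _).1 subset_rfl

open Classical in
theorem OpenSets.comul_apply {X : Type u} [TopologicalSpace X] [Fintype X] (U : OpenSets X) :
    OpenSets.comul X U =
      ∑ x : X with x ∈ U, OpenSets.minOpen x ⊗ₜ[𝔹.{u}] OpenSets.minOpen x :=
  Finset.sum_congr (Finset.filter_congr fun x _ => OpenSets.minOpen_subset_iff x U) fun _ _ => rfl

theorem coev_one (X : Type u) [TopologicalSpace X] [Fintype X] :
    coev X 1 = ∑ x : X, OpenSets.minOpen x ⊗ₜ[𝔹.{u}] OpenSets.minOpen (toDual x) :=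
  one_smul 𝔹.{u} (∑ x : X, OpenSets.minOpen x ⊗ₜ[𝔹.{u}] OpenSets.minOpen (toDual x))

/-! ### Points are preserved by foams; evaluation of closed foams -/

section ClosedFoams

/-- A functional that takes the value one wherever another one does. -/
def FunctionalLE {M : SemimoduleCat.{u} 𝔹.{u}} (p q : M ⟶ 𝟙_ (SemimoduleCat.{u} 𝔹.{u})) : Prop :=
  ∀ t : M, p.hom t = (1 : 𝔹.{u}) → q.hom t = (1 : 𝔹.{u})

theorem FunctionalLE.comp {M N : SemimoduleCat.{u} 𝔹.{u}}
    {p q : N ⟶ 𝟙_ (SemimoduleCat.{u} 𝔹.{u})} (h : FunctionalLE p q) (f : M ⟶ N) :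
    FunctionalLE (f ≫ p) (f ≫ q) := fun t => h (f.hom t)

theorem FunctionalLE.trans {M : SemimoduleCat.{u} 𝔹.{u}}
    {p q r : M ⟶ 𝟙_ (SemimoduleCat.{u} 𝔹.{u})} (h : FunctionalLE p q) (h' : FunctionalLE q r) :
    FunctionalLE p r := fun t ht => h' t (h t ht)

theorem FunctionalLE.of_eq {M : SemimoduleCat.{u} 𝔹.{u}}
    {p q : M ⟶ 𝟙_ (SemimoduleCat.{u} 𝔹.{u})} (h : p = q) : FunctionalLE p q := fun _ ht => h ▸ ht

theorem FunctionalLE.tensor {M N : SemimoduleCat.{u} 𝔹.{u}}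
    {p p' : M ⟶ 𝟙_ (SemimoduleCat.{u} 𝔹.{u})} {q q' : N ⟶ 𝟙_ (SemimoduleCat.{u} 𝔹.{u})}
    (h : FunctionalLE p p') (h' : FunctionalLE q q') :
    FunctionalLE (tensorFunctional p q) (tensorFunctional p' q') :=
  functional_le_of_tmul fun _ _ hxy =>
    have := tensorFunctional_tmul_eq_one.1 hxy
    tensorFunctional_tmul_eq_one.2 ⟨h _ this.1, h' _ this.2⟩

variable {X : Type u} [TopologicalSpace X] [Fintype X] (x : X)

/-- The functional on the state space of a point that tests membership of `x`. -/
noncomputable def stateFunctional : ∀ s : Sign, state X s ⟶ 𝟙_ (SemimoduleCat.{u} 𝔹.{u})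
  | plus => SemimoduleCat.ofHom (OpenSets.memFunctional x)
  | minus => SemimoduleCat.ofHom (OpenSets.memFunctional (toDual x))

theorem mul_functionalLE {Y : Type u} [TopologicalSpace Y] (y : Y) :
    FunctionalLE (tensorFunctional (M := SemimoduleCat.of 𝔹.{u} (OpenSets Y))
        (N := SemimoduleCat.of 𝔹.{u} (OpenSets Y)) (SemimoduleCat.ofHom (OpenSets.memFunctional y))
        (SemimoduleCat.ofHom (OpenSets.memFunctional y)))
      (SemimoduleCat.ofHom (OpenSets.mul Y) ≫ SemimoduleCat.ofHom (OpenSets.memFunctional y)) :=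
  functional_le_of_tmul fun U V h => by
    have h := tensorFunctional_tmul_eq_one.1 h
    exact OpenSets.memFunctional_eq_one.2
      ⟨OpenSets.memFunctional_eq_one.1 h.1, OpenSets.memFunctional_eq_one.1 h.2⟩

/-- If `y` lies in `U`, then `U_y ⊗ U_y` is one of the summands of `Δ(U)`, and both of its factors
contain `y`. -/
theorem comul_functionalLE {Y : Type u} [TopologicalSpace Y] [Fintype Y] (y : Y) :
    FunctionalLE (M := SemimoduleCat.of 𝔹.{u} (OpenSets Y))
      (SemimoduleCat.ofHom (OpenSets.memFunctional y))
      (SemimoduleCat.ofHom (OpenSets.comul Y) ≫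
        tensorFunctional (M := SemimoduleCat.of 𝔹.{u} (OpenSets Y))
        (N := SemimoduleCat.of 𝔹.{u} (OpenSets Y)) (SemimoduleCat.ofHom (OpenSets.memFunctional y))
        (SemimoduleCat.ofHom (OpenSets.memFunctional y))) := by
  classical
  intro U hU
  have hU : y ∈ (U : OpenSets Y) := OpenSets.memFunctional_eq_one.1 hU
  have e := map_sum (tensorFunctional (M := SemimoduleCat.of 𝔹.{u} (OpenSets Y))
        (N := SemimoduleCat.of 𝔹.{u} (OpenSets Y)) (SemimoduleCat.ofHom (OpenSets.memFunctional y))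
        (SemimoduleCat.ofHom (OpenSets.memFunctional y))).hom
    (fun x : Y => OpenSets.minOpen x ⊗ₜ[𝔹.{u}] OpenSets.minOpen x)
    (Finset.univ.filter fun x : Y => x ∈ (U : OpenSets Y))
  refine (congrArg (tensorFunctional (M := SemimoduleCat.of 𝔹.{u} (OpenSets Y))
        (N := SemimoduleCat.of 𝔹.{u} (OpenSets Y)) (SemimoduleCat.ofHom (OpenSets.memFunctional y))
        (SemimoduleCat.ofHom (OpenSets.memFunctional y))).hom (OpenSets.comul_apply U)).trans
    (e.trans (𝔹.sum_eq_one.2 ⟨y, by simpa using hU, ?_⟩))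
  exact tensorFunctional_tmul_eq_one.2
    ⟨OpenSets.memFunctional_eq_one.2 (OpenSets.mem_minOpen_self y),
      OpenSets.memFunctional_eq_one.2 (OpenSets.mem_minOpen_self y)⟩

theorem stateMul_functionalLE (s : Sign) :
    FunctionalLE (tensorFunctional (stateFunctional x s) (stateFunctional x s))
      (stateMul X s ≫ stateFunctional x s) := by
  cases s
  · exact mul_functionalLE x
  · exact mul_functionalLE (toDual x)

theorem stateComul_functionalLE (s : Sign) :
    FunctionalLE (stateFunctional x s)
      (stateComul X s ≫ tensorFunctional (stateFunctional x s) (stateFunctional x s)) := by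
  cases s
  · exact comul_functionalLE x
  · exact comul_functionalLE (toDual x)

theorem functionalLE_scalar {q : 𝟙_ (SemimoduleCat.{u} 𝔹.{u}) ⟶ 𝟙_ (SemimoduleCat.{u} 𝔹.{u})}
    (h : q.hom (1 : 𝔹.{u}) = (1 : 𝔹.{u})) : FunctionalLE (𝟙 _) q := by
  intro t ht
  have ht : t = (1 : 𝔹.{u}) := ht
  rw [ht]; exact h

theorem stateUnit_functionalLE (s : Sign) :
    FunctionalLE (𝟙 _) (stateUnit X s ≫ stateFunctional x s) := by
  refine functionalLE_scalar ?_
  cases s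
  · exact OpenSets.memFunctional_eq_one.2 trivial
  · exact OpenSets.memFunctional_eq_one.2 trivial

theorem stateCounit_functionalLE (s : Sign) :
    FunctionalLE (stateFunctional x s) (stateCounit X s) := by
  intro U hU
  cases s
  · exact 𝔹.truth_eq_one.2 ⟨x, OpenSets.memFunctional_eq_one.1 hU⟩
  · exact 𝔹.truth_eq_one.2 ⟨toDual x, OpenSets.memFunctional_eq_one.1 hU⟩

/-- The summand `U_x ⊗ V_x` of the coevaluation contains `x` in both factors. -/
theorem stateCup_functionalLE :
    FunctionalLE (𝟙 _)
      (stateCup X ≫ tensorFunctional (stateFunctional x plus) (stateFunctional x minus)) := by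
  refine functionalLE_scalar ?_
  have e := map_sum (tensorFunctional (stateFunctional x plus) (stateFunctional x minus)).hom
    (fun y : X => OpenSets.minOpen y ⊗ₜ[𝔹.{u}] OpenSets.minOpen (toDual y)) Finset.univ
  refine (congrArg (tensorFunctional (stateFunctional x plus) (stateFunctional x minus)).hom
    (coev_one X)).trans (e.trans (𝔹.sum_eq_one.2 ⟨x, Finset.mem_univ x, ?_⟩))
  exact tensorFunctional_tmul_eq_one.2
    ⟨OpenSets.memFunctional_eq_one.2 (OpenSets.mem_minOpen_self _),
      OpenSets.memFunctional_eq_one.2 (OpenSets.mem_minOpen_self _)⟩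

theorem stateCap_functionalLE :
    FunctionalLE (tensorFunctional (stateFunctional x minus) (stateFunctional x plus))
      (stateCap X) :=
  functional_le_of_tmul fun V U h => by
    have h := tensorFunctional_tmul_eq_one.1 h
    exact 𝔹.truth_eq_one.2
      ⟨x, OpenSets.memFunctional_eq_one.1 h.1, OpenSets.memFunctional_eq_one.1 h.2⟩

variable {sm : Prop} (F : FoamFunctor sm X)

/-- The functional on the value of a foam functor that tests membership of `x` in all positions. -/
noncomputable def pointFunctional (a : List Sign) :
    F.functor.obj ⟨a⟩ ⟶ 𝟙_ (SemimoduleCat.{u} 𝔹.{u}) :=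
  listFunctional F.functor (fun s => (F.ptIso s).hom ≫ stateFunctional x s) a

theorem pointFunctional_singleton (s : Sign) :
    pointFunctional x F [s] = (F.ptIso s).hom ≫ stateFunctional x s :=
  listFunctional_singleton _ _ s

theorem pointFunctional_append (a b : List Sign) :
    pointFunctional x F (a ++ b) =
      δ F.functor ⟨a⟩ ⟨b⟩ ≫ tensorFunctional (pointFunctional x F a) (pointFunctional x F b) :=
  listFunctional_append _ _ a b

theorem tensorFunctional_comp {C : Type*} [Category C] [MonoidalCategory C] {M N M' N' : C}
    (f : M ⟶ M') (g : N ⟶ N') (p : M' ⟶ 𝟙_ C) (q : N' ⟶ 𝟙_ C) :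
    tensorFunctional (f ≫ p) (g ≫ q) = (f ⊗ₘ g) ≫ tensorFunctional p q := by
  simp [tensorFunctional]

/-- This form matches the shape in which a `FoamFunctor` prescribes its values on generators with
two boundary points on one side. -/
theorem pointFunctional_pair (s s' : Sign) :
    pointFunctional x F [s, s'] =
      δ F.functor (FCob.pt s) (FCob.pt s') ≫ ((F.ptIso s).hom ⊗ₘ (F.ptIso s').hom) ≫
        tensorFunctional (stateFunctional x s) (stateFunctional x s') := by
  refine (pointFunctional_append x F [s] [s']).trans ?_
  rw [pointFunctional_singleton, pointFunctional_singleton]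
  exact congrArg (δ F.functor (FCob.pt s) (FCob.pt s') ≫ ·) (tensorFunctional_comp _ _ _ _)

theorem braiding_tensorFunctional {C : Type*} [Category C] [MonoidalCategory C]
    [SymmetricCategory C] {M N : C} (p : M ⟶ 𝟙_ C) (q : N ⟶ 𝟙_ C) :
    (β_ M N).hom ≫ tensorFunctional q p = tensorFunctional p q := by
  simp only [tensorFunctional]
  rw [← BraidedCategory.braiding_naturality_assoc, braiding_leftUnitor, unitors_equal]

/-- Every one-foam preserves the points of the state spaces. -/
theorem pointFunctional_le : ∀ {a b : List Sign} (f : Diagram a b),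
    FunctionalLE (pointFunctional x F a)
      (F.functor.map (FCob.ofDiagram f : (⟨a⟩ : FCob sm) ⟶ ⟨b⟩) ≫ pointFunctional x F b) := by
  intro a b f
  induction f with
  | @strands a b h =>
    cases h
    refine .of_eq ?_
    exact (Category.id_comp _).symm.trans (congrArg (· ≫ pointFunctional x F a)
      (F.functor.map_id ⟨a⟩).symm)
  | @comp a b c f g hf hg =>
    refine hf.trans ((hg.comp _).trans (.of_eq ?_))
    refine (Category.assoc _ _ _).symm.trans ?_
    exact congrArg (· ≫ pointFunctional x F c)
      (F.functor.map_comp (FCob.ofDiagram f : (⟨a⟩ : FCob sm) ⟶ ⟨b⟩) (FCob.ofDiagram g)).symm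
  | @juxt a b c d f g hf hg =>
    rw [pointFunctional_append, pointFunctional_append]
    -- Tensoring functionals is monotone, and naturality of `δ` moves the two foams past the cut.
    refine ((hf.tensor hg).comp _).trans (.of_eq ?_)
    have e := Functor.OplaxMonoidal.δ_natural F.functor
      (FCob.ofDiagram f : (⟨a⟩ : FCob sm) ⟶ ⟨b⟩) (FCob.ofDiagram g : (⟨c⟩ : FCob sm) ⟶ ⟨d⟩)
    rw [tensorFunctional_comp, reassoc_of% e]
    rfl
  | braid a c =>
    rw [pointFunctional_append, pointFunctional_append]
    refine .of_eq ?_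
    have e := Functor.map_braiding F.functor (⟨a⟩ : FCob sm) ⟨c⟩
    have e' := congrArg (· ≫ δ F.functor (⟨c⟩ : FCob sm) ⟨a⟩ ≫
      tensorFunctional (pointFunctional x F c) (pointFunctional x F a)) e
    refine Eq.trans ?_ e'.symm
    simp only [Category.assoc, Functor.Monoidal.μ_δ_assoc, braiding_tensorFunctional]
  | cup =>
    rw [pointFunctional_pair]
    -- On the empty sequence the functional is `η`, so the inequality for the state spaces is pulled
    -- back along `η`.
    refine FunctionalLE.trans (.of_eq (Category.comp_id _).symm)
      (((stateCup_functionalLE x).comp (η F.functor)).trans (.of_eq ?_))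
    rw [← F.map_cup]
    simp only [Category.assoc, Functor.Monoidal.η_ε_assoc]
    rfl
  | cap =>
    rw [pointFunctional_pair]
    refine (((stateCap_functionalLE x).comp _).comp _).trans (.of_eq ?_)
    rw [← F.map_cap]
    exact Functor.Monoidal.δ_μ_assoc (F := F.functor) (FCob.pt minus) (FCob.pt plus) _
  | mul s =>
    rw [pointFunctional_pair, pointFunctional_singleton]
    refine (((stateMul_functionalLE x s).comp _).comp _).trans (.of_eq ?_)
    have e := congrArg (δ F.functor (FCob.pt s) (FCob.pt s) ≫ · ≫ stateFunctional x s) (F.map_mul s)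
    simp only [Category.assoc, Functor.Monoidal.δ_μ_assoc] at e
    exact e.symm
  | comul s =>
    rw [pointFunctional_pair, pointFunctional_singleton]
    refine ((stateComul_functionalLE x s).comp _).trans (.of_eq ?_)
    have e := congrArg (· ≫ tensorFunctional (stateFunctional x s) (stateFunctional x s))
      (F.map_comul s)
    simp only [Category.assoc] at e
    exact e.symm
  | unit s =>
    rw [pointFunctional_singleton]
    refine FunctionalLE.trans (.of_eq (Category.comp_id _).symm)
      (((stateUnit_functionalLE x s).comp (η F.functor)).trans (.of_eq ?_))
    rw [← F.map_unit]
    simp only [Category.assoc, Functor.Monoidal.η_ε_assoc]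
    rfl
  | counit s =>
    rw [pointFunctional_singleton]
    refine ((stateCounit_functionalLE x s).comp _).trans (.of_eq ?_)
    exact (F.map_counit s).symm

/-- Both ends of a closed foam carry the functional `η`, whose value at `ε(1)` is `1`; preservation
of any one point then forces the value `1`. -/
theorem FoamFunctor.eval_eq_one [Nonempty X] (C : 𝟙_ (FCob sm) ⟶ 𝟙_ (FCob sm)) :
    F.eval C = 1 := by
  obtain ⟨f⟩ := C
  have h := (pointFunctional_le (Classical.arbitrary X) F f).comp (ε F.functor) (1 : 𝔹.{u})
  refine h ?_
  change (ε F.functor ≫ η F.functor).hom (1 : 𝔹.{u}) = (1 : 𝔹.{u})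
  rw [Functor.Monoidal.ε_η]
  rfl

end ClosedFoams

/-! ### The symmetric monoidal functor defined by generators -/

section FunctorOfGenerators

universe v w

variable {C : Type w} [Category.{v} C] [MonoidalCategory C] [SymmetricCategory C] {S : Sign → C}
  (G : Generators S) {sm : Prop}
  (hG : ∀ {a b : List Sign} {f g : Diagram a b}, Rel sm f g → G.eval f = G.eval g)

/-- The functor from one-foams that is determined by the values of the generators. -/
def Generators.functor : FCob sm ⥤ C where
  obj A := listObj S A.signs
  map f := Quotient.lift G.eval (fun _ _ h => hG h) f
  map_id _ := rfl
  map_comp := by rintro _ _ _ ⟨f⟩ ⟨g⟩; rfl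

/-- The tensorators of the functor determined by the values of the generators. -/
def Generators.coreMonoidal : (G.functor hG).CoreMonoidal where
  εIso := Iso.refl _
  μIso A B := appendIso S A.signs B.signs
  μIso_hom_natural_left := by
    rintro A B ⟨f⟩ A'
    change G.eval f ▷ _ ≫ _ = _ ≫ juxtHom (G.eval f) (𝟙 _)
    rw [juxtHom, tensorHom_id]
    exact (Iso.hom_inv_id_assoc (appendIso S A.signs A'.signs) _).symm
  μIso_hom_natural_right := by
    rintro A B A' ⟨f⟩
    change _ ◁ G.eval f ≫ _ = _ ≫ juxtHom (𝟙 _) (G.eval f)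
    rw [juxtHom, id_tensorHom]
    exact (Iso.hom_inv_id_assoc (appendIso S A'.signs A.signs) _).symm
  associativity A B D := appendIso_assoc S A.signs B.signs D.signs
  left_unitality A := by
    change (λ_ (listObj S A.signs)).hom =
      𝟙 (𝟙_ C) ▷ _ ≫ (λ_ (listObj S A.signs)).hom ≫ 𝟙 (listObj S A.signs)
    simp
  right_unitality A := by
    change (ρ_ (listObj S A.signs)).hom =
      listObj S A.signs ◁ 𝟙 (𝟙_ C) ≫ (appendIso S A.signs []).hom ≫
        eqToHom (congrArg (listObj S) (List.append_nil A.signs))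
    rw [whiskerLeft_id]
    exact (appendIso_nil S A.signs).symm.trans (Category.id_comp _).symm

/-- The functor determined by the values of the generators is symmetric monoidal. -/
@[reducible]
def Generators.braided : (G.functor hG).Braided where
  toMonoidal := (G.coreMonoidal hG).toMonoidal
  braided A B := by
    change (appendIso S A.signs B.signs).hom ≫ braidHom S A.signs B.signs =
      (β_ (listObj S A.signs) (listObj S B.signs)).hom ≫ (appendIso S B.signs A.signs).hom
    simp [braidHom]

end FunctorOfGenerators

/-! ### Points and smallest neighbourhoods in the state spaces -/

section Elements

variable (X : Type u) [TopologicalSpace X] [Fintype X]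

/-- The values of the generating one-foams for a finite space. -/
noncomputable def stateGenerators : Generators (state X) where
  cup := stateCup X
  cap := stateCap X
  mul := stateMul X
  comul := stateComul X
  unit := stateUnit X
  counit := stateCounit X


variable {X}

/-- Membership of a point in an element of a state space. -/
def Mem : ∀ (s : Sign) (_ : X) (_ : state X s), Prop
  | plus, x, U => x ∈ (U : OpenSets X)
  | minus, x, V => toDual x ∈ (V : OpenSets (DualSpace X))

/-- The smallest element of a state space that contains a given point. -/
def nbhd : ∀ (s : Sign) (_ : X), state X s
  | plus, x => OpenSets.minOpen x
  | minus, x => OpenSets.minOpen (toDual x)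

theorem state_ext {s : Sign} {u v : state X s} (h : ∀ x, Mem s x u ↔ Mem s x v) : u = v := by
  cases s
  · exact OpenSets.ext h
  · exact OpenSets.ext h

theorem mem_add (s : Sign) (x : X) (u v : state X s) : Mem s x (u + v) ↔ Mem s x u ∨ Mem s x v := by
  cases s <;> exact Iff.rfl

theorem mem_nbhd_self (s : Sign) (x : X) : Mem s x (nbhd s x) := by
  cases s
  · exact OpenSets.mem_minOpen_self x
  · exact OpenSets.mem_minOpen_self (toDual x)

theorem mem_of_mem_nbhd {s : Sign} {x y : X} {u : state X s} (hx : Mem s x u)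
    (hy : Mem s y (nbhd s x)) : Mem s y u := by
  cases s
  · exact (OpenSets.minOpen_subset_iff x u).2 hx hy
  · exact (OpenSets.minOpen_subset_iff (toDual x) u).2 hx hy

/-- Both sides express the specialization order. If `x` is not in `U_y`, the complement of `U_y` is
a closed set containing `x`, hence it contains `V_x`, which therefore misses `y`. The converse uses
the open complement of `V_x`. -/
theorem mem_nbhd_minus_iff {x y : X} : Mem minus y (nbhd minus x) ↔ Mem plus x (nbhd plus y) := by
  constructor
  · intro h
    by_contra hx
    let W : Opens (DualSpace X) :=
      ⟨(OpenSets.minOpen y : Set X)ᶜ, (nbhd plus y : Opens X).isOpen.isClosed_compl⟩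
    exact (OpenSets.minOpen_subset_iff (toDual x) W).2 hx h (OpenSets.mem_minOpen_self y)
  · intro h
    by_contra hy
    let W : Opens X :=
      ⟨(OpenSets.minOpen (toDual x) : Set (DualSpace X))ᶜ,
        IsClosed.isOpen_compl (X := X) (self := (nbhd minus x : Opens (DualSpace X)).isOpen)⟩
    exact (OpenSets.minOpen_subset_iff y W).2 hy h (OpenSets.mem_minOpen_self (toDual x))

/-- The order given by absorption on a module over the Boolean semiring. -/
def Absorbs {M : Type*} [AddCommMonoid M] (a b : M) : Prop := a + b = b

/-! ### The absorption order: sums are joins, linear maps are monotone -/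

section Absorbs

variable {M N P : Type*} [AddCommMonoid M] [AddCommMonoid N] [AddCommMonoid P]

/-- Two sums of pure tensors with different summands are proved equal in this way: each summand of
one is absorbed by some summand of the other. -/
theorem Absorbs.antisymm {a b : M} (h : Absorbs a b) (h' : Absorbs b a) : a = b :=
  h'.symm.trans ((add_comm b a).trans h)

theorem Absorbs.trans {a b c : M} (h : Absorbs a b) (h' : Absorbs b c) : Absorbs a c := by
  unfold Absorbs at *
  rw [← h', ← add_assoc, h]

theorem Absorbs.add {a b c : M} (h : Absorbs a c) (h' : Absorbs b c) : Absorbs (a + b) c := by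
  unfold Absorbs at *
  rw [add_assoc, h', h]

theorem Absorbs.sum {ι : Type*} {s : Finset ι} {f : ι → M} {b : M}
    (h : ∀ i ∈ s, Absorbs (f i) b) : Absorbs (∑ i ∈ s, f i) b := by
  classical
  induction s using Finset.induction_on with
  | empty => exact zero_add b
  | insert i s hi ih =>
    rw [Finset.sum_insert hi]
    exact (h i (Finset.mem_insert_self i s)).add
      (ih fun j hj => h j (Finset.mem_insert_of_mem hj))

variable [Module 𝔹.{u} M] [Module 𝔹.{u} N] [Module 𝔹.{u} P]

theorem add_self_of_module (a : M) : a + a = a := by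
  conv_rhs => rw [← one_smul 𝔹.{u} a, ← 𝔹.add_idem 1, add_smul, one_smul]

theorem Absorbs.map {a b : M} (h : Absorbs a b) (f : M →ₗ[𝔹.{u}] N) : Absorbs (f a) (f b) := by
  unfold Absorbs at *
  rw [← map_add, h]

theorem Absorbs.map₂ {a b : M} {c d : N} (h : Absorbs a b) (h' : Absorbs c d)
    (f : M →ₗ[𝔹.{u}] N →ₗ[𝔹.{u}] P) : Absorbs (f a c) (f b d) :=
  (h'.map (f a)).trans (h.map (f.flip d))

variable (M) in
theorem Absorbs.refl (a : M) : Absorbs a a := add_self_of_module.{u} a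

theorem absorbs_sum {ι : Type*} [Fintype ι] (f : ι → M) (i : ι) : Absorbs (f i) (∑ j, f j) := by
  classical
  unfold Absorbs
  rw [← Finset.add_sum_erase _ _ (Finset.mem_univ i), ← add_assoc, add_self_of_module.{u}]

theorem Absorbs.truth_smul {p : Prop} {a b : M} (h : p → Absorbs a b) :
    Absorbs (𝔹.truth.{u} p • a) b := by
  by_cases hp : p
  · simpa [𝔹.truth, hp] using h hp
  · simp [𝔹.truth, hp, Absorbs]

theorem truth_smul_of {p : Prop} (hp : p) (a : M) : 𝔹.truth.{u} p • a = a := by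
  simp [𝔹.truth, hp]

/-- Addition in `𝔹` is disjunction. Writing the existential in a pairing as a sum over points allows
comparison with the sums in the comultiplication. -/
theorem truth_exists_smul {ι : Type*} [Fintype ι] (p : ι → Prop) (a : M) :
    𝔹.truth.{u} (∃ i, p i) • a = ∑ i, 𝔹.truth.{u} (p i) • a := by
  refine Absorbs.antisymm (Absorbs.truth_smul fun ⟨i, hi⟩ => ?_)
    (Absorbs.sum fun i _ => Absorbs.truth_smul fun hi => ?_)
  · have := absorbs_sum.{u} (fun i => 𝔹.truth.{u} (p i) • a) i
    rwa [truth_smul_of hi] at this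
  · rw [truth_smul_of ⟨i, hi⟩]
    exact Absorbs.refl.{u} M a

theorem truth_smul_truth_smul (p q : Prop) (a : M) :
    𝔹.truth.{u} p • 𝔹.truth.{u} q • a = 𝔹.truth.{u} (p ∧ q) • a := by
  by_cases hp : p <;> by_cases hq : q <;> simp [𝔹.truth, hp, hq]

theorem map_sum_truth_smul {ι : Type*} [Fintype ι] (f : M →ₗ[𝔹.{u}] N) (p : ι → Prop)
    {a : ι → M} {b : ι → N} (h : ∀ i, f (a i) = b i) :
    f (∑ i, 𝔹.truth.{u} (p i) • a i) = ∑ i, 𝔹.truth.{u} (p i) • b i := by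
  simp [h]

theorem map_sum_of_eq {ι : Type*} [Fintype ι] (f : M →ₗ[𝔹.{u}] N)
    {a : ι → M} {b : ι → N} (h : ∀ i, f (a i) = b i) : f (∑ i, a i) = ∑ i, b i := by
  simp [h]

end Absorbs

theorem absorbs_of_mem {s : Sign} {u v : state X s} (h : ∀ x, Mem s x u → Mem s x v) :
    Absorbs u v :=
  state_ext fun x => by rw [mem_add]; exact ⟨fun h' => h'.elim (h x) id, .inr⟩

theorem mem_of_absorbs {s : Sign} {u v : state X s} (h : Absorbs u v) {x : X} (hx : Mem s x u) :
    Mem s x v := by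
  rw [← show u + v = v from h, mem_add]; exact .inl hx

theorem absorbs_nbhd {s : Sign} {x y : X} (h : Mem s y (nbhd s x)) :
    Absorbs (nbhd s y) (nbhd s x) :=
  absorbs_of_mem fun _ hz => mem_of_mem_nbhd h hz

theorem nbhd_absorbs {s : Sign} {x : X} {u : state X s} (h : Mem s x u) : Absorbs (nbhd s x) u :=
  absorbs_of_mem fun _ hz => mem_of_mem_nbhd h hz

/-- Each `U_x` with `x` in `u` is contained in `u`, and each point of `u` lies in its own `U_x`. The
zigzags, counitality and "split then merge" all come down to this identity. -/
theorem sum_nbhd {s : Sign} (u : state X s) : ∑ x, 𝔹.truth.{u} (Mem s x u) • nbhd s x = u := by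
  refine Absorbs.antisymm (Absorbs.sum fun x _ => Absorbs.truth_smul nbhd_absorbs)
    (absorbs_of_mem fun x hx => ?_)
  have := absorbs_sum.{u} (fun x => 𝔹.truth.{u} (Mem s x u) • nbhd s x) x
  rw [truth_smul_of hx] at this
  exact mem_of_absorbs this (mem_nbhd_self s x)

/-- The product of the state spaces. -/
def stateProd (s : Sign) (u v : state X s) : state X s := (stateMul X s).hom (u ⊗ₜ[𝔹.{u}] v)

theorem mem_stateProd {s : Sign} {x : X} {u v : state X s} :
    Mem s x (stateProd s u v) ↔ Mem s x u ∧ Mem s x v := by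
  cases s <;> exact Iff.rfl

/-- The unit of the state spaces. -/
def full (X : Type u) [TopologicalSpace X] [Fintype X] (s : Sign) : state X s :=
  (stateUnit X s).hom (1 : 𝔹.{u})

theorem mem_full (s : Sign) (x : X) : Mem s x (full X s) := by
  cases s <;> exact trivial

/-- Replacing the filtered sum by Boolean coefficients over all points lets linear maps be applied
termwise and coefficients be multiplied. -/
theorem stateComul_apply (s : Sign) (u : state X s) :
    (stateComul X s).hom u =
      ∑ x, 𝔹.truth.{u} (Mem s x u) • (nbhd s x ⊗ₜ[𝔹.{u}] nbhd s x) := by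
  have h : ∀ {Y : Type u} [TopologicalSpace Y] [Fintype Y] (U : OpenSets Y),
      OpenSets.comul Y U = ∑ y : Y, 𝔹.truth.{u} (y ∈ U) •
        (OpenSets.minOpen y ⊗ₜ[𝔹.{u}] OpenSets.minOpen y) := fun {Y} _ _ U => by
    classical
    rw [OpenSets.comul_apply, Finset.sum_filter]
    refine Finset.sum_congr rfl fun y _ => ?_
    by_cases hy : y ∈ U <;> simp [𝔹.truth, hy]
  cases s
  · exact h (Y := X) u
  · exact h (Y := DualSpace X) u

theorem stateCounit_apply (s : Sign) (u : state X s) :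
    (stateCounit X s).hom u = 𝔹.truth.{u} (∃ x, Mem s x u) := by
  cases s <;> rfl

theorem stateCup_apply :
    (stateCup X).hom (1 : 𝔹.{u}) = ∑ x, nbhd plus x ⊗ₜ[𝔹.{u}] nbhd minus x := coev_one X

end Elements

/-! ### The action of diagrams on pure tensors -/

section Relations

variable {X : Type u} [TopologicalSpace X] [Fintype X]

variable (X) in
/-- The module attached to a sign sequence. -/
abbrev Elem (a : List Sign) : Type u := (listObj (state X) a : SemimoduleCat.{u} 𝔹.{u})

/-- The generator of the module of the empty sequence. -/
def nil : Elem X [] := (1 : 𝔹.{u})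

/-- Pure tensors: prepending an element of a state space. -/
noncomputable def cons (s : Sign) (a : List Sign) :
    (state X s : Type u) →ₗ[𝔹.{u}] Elem X a →ₗ[𝔹.{u}] Elem X (s :: a) :=
  TensorProduct.mk 𝔹.{u} (state X s) (Elem X a)

/-- Concatenation of tensors. -/
noncomputable def app (a b : List Sign) :
    Elem X a →ₗ[𝔹.{u}] Elem X b →ₗ[𝔹.{u}] Elem X (a ++ b) :=
  (TensorProduct.mk 𝔹.{u} (Elem X a) (Elem X b)).compr₂ (appendIso (state X) a b).hom.hom

theorem app_nil_left {a : List Sign} (y : Elem X a) : app [] a nil y = y := one_smul 𝔹.{u} y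

theorem app_singleton {s : Sign} {b : List Sign} (u : state X s) (y : Elem X b) :
    app [s] b (cons s [] u nil) y = cons s b u y :=
  congrArg (cons s b u) (app_nil_left y)

theorem app_pair {s t : Sign} {b : List Sign} (u : state X s) (v : state X t) (y : Elem X b) :
    app [s, t] b (cons s [t] u (cons t [] v nil)) y = cons s (t :: b) u (cons t b v y) :=
  congrArg (cons s (t :: b) u) (app_singleton v y)

theorem app_triple {s t r : Sign} {b : List Sign} (u : state X s) (v : state X t) (w : state X r)
    (y : Elem X b) :
    app [s, t, r] b (cons s [t, r] u (cons t [r] v (cons r [] w nil))) y =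
      cons s (t :: r :: b) u (cons t (r :: b) v (cons r b w y)) :=
  congrArg (cons s (t :: r :: b) u) (app_pair v w y)

theorem hom_nil_ext {M : SemimoduleCat.{u} 𝔹.{u}} {f g : listObj (state X) [] ⟶ M}
    (h : f.hom (nil : Elem X []) = g.hom (nil : Elem X [])) : f = g :=
  SemimoduleCat.hom_ext (LinearMap.ext_ring h)

theorem hom_cons_ext {M : SemimoduleCat.{u} 𝔹.{u}} {s : Sign} {a : List Sign}
    {f g : listObj (state X) (s :: a) ⟶ M}
    (h : ∀ (u : state X s) (x : Elem X a), f.hom (cons s a u x) = g.hom (cons s a u x)) : f = g :=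
  SemimoduleCat.MonoidalCategory.tensor_ext h

/-- The last tensor factor is `𝔹`, on which a linear map is determined by its value at `1`, so pure
tensors ending in `nil` suffice. -/
theorem hom_singleton_ext {M : SemimoduleCat.{u} 𝔹.{u}} {s : Sign}
    {f g : listObj (state X) [s] ⟶ M}
    (h : ∀ u : state X s, f.hom (cons s [] u nil) = g.hom (cons s [] u nil)) : f = g :=
  hom_cons_ext fun u => LinearMap.congr_fun
    (LinearMap.ext_ring (h u) : f.hom.comp (cons s [] u) = g.hom.comp (cons s [] u))

theorem hom_pair_ext {M : SemimoduleCat.{u} 𝔹.{u}} {s t : Sign}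
    {f g : listObj (state X) [s, t] ⟶ M}
    (h : ∀ (u : state X s) (v : state X t),
      f.hom (cons s [t] u (cons t [] v nil)) = g.hom (cons s [t] u (cons t [] v nil))) : f = g :=
  hom_cons_ext fun u => LinearMap.congr_fun (f := f.hom.comp (cons s [t] u))
    (g := g.hom.comp (cons s [t] u)) (congrArg SemimoduleCat.Hom.hom
      (hom_singleton_ext (f := SemimoduleCat.ofHom (f.hom.comp (cons s [t] u)))
        (g := SemimoduleCat.ofHom (g.hom.comp (cons s [t] u))) (h u)))

theorem hom_triple_ext {M : SemimoduleCat.{u} 𝔹.{u}} {s t r : Sign}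
    {f g : listObj (state X) [s, t, r] ⟶ M}
    (h : ∀ (u : state X s) (v : state X t) (w : state X r),
      f.hom (cons s [t, r] u (cons t [r] v (cons r [] w nil))) =
        g.hom (cons s [t, r] u (cons t [r] v (cons r [] w nil)))) : f = g :=
  hom_cons_ext fun u => LinearMap.congr_fun (f := f.hom.comp (cons s [t, r] u))
    (g := g.hom.comp (cons s [t, r] u)) (congrArg SemimoduleCat.Hom.hom
      (hom_pair_ext (f := SemimoduleCat.ofHom (f.hom.comp (cons s [t, r] u)))
        (g := SemimoduleCat.ofHom (g.hom.comp (cons s [t, r] u))) (h u)))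

variable (X) in
/-- The linear map of a diagram. -/
noncomputable def act {a b : List Sign} (f : Diagram a b) : Elem X a →ₗ[𝔹.{u}] Elem X b :=
  ((stateGenerators X).eval f).hom

theorem act_idt {a : List Sign} (x : Elem X a) : act X (.idt a) x = x := rfl

theorem act_juxt {a b c d : List Sign} (f : Diagram a b) (g : Diagram c d) (x : Elem X a)
    (y : Elem X c) : act X (.juxt f g) (app a c x y) = app b d (act X f x) (act X g y) :=
  congrArg (fun t => (appendIso (state X) b d).hom.hom
    ((((stateGenerators X).eval f) ⊗ₘ ((stateGenerators X).eval g)).hom t))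
    (SemimoduleCat.inv_hom_apply (appendIso (state X) a c) (x ⊗ₜ[𝔹.{u}] y))

theorem act_braid {a c : List Sign} (x : Elem X a) (y : Elem X c) :
    act X (.braid a c) (app a c x y) = app c a y x :=
  congrArg (fun t => (appendIso (state X) c a).hom.hom
    ((β_ (listObj (state X) a) (listObj (state X) c)).hom.hom t))
    (SemimoduleCat.inv_hom_apply (appendIso (state X) a c) (x ⊗ₜ[𝔹.{u}] y))

theorem act_braid_singleton {s t : Sign} (u : state X s) (v : state X t) :
    act X (.braid [s] [t]) (cons s [t] u (cons t [] v nil)) = cons t [s] v (cons s [] u nil) := by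
  refine (congrArg _ (app_singleton u (cons t [] v nil)).symm).trans ((act_braid _ _).trans ?_)
  exact app_singleton v _

/-- To apply `act_juxt`, the input must be written as a concatenation cut after the source of the
left diagram; here the left part is `nil`. -/
theorem act_juxt_nil {b c d : List Sign} (f : Diagram [] b) (g : Diagram c d) (y : Elem X c) :
    act X (.juxt f g) y = app b d (act X f nil) (act X g y) :=
  (congrArg _ (app_nil_left y).symm).trans (act_juxt f g nil y)

theorem act_juxt_singleton {s : Sign} {b c d : List Sign} (f : Diagram [s] b) (g : Diagram c d)
    (u : state X s) (y : Elem X c) :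
    act X (.juxt f g) (cons s c u y) = app b d (act X f (cons s [] u nil)) (act X g y) :=
  (congrArg _ (app_singleton u y).symm).trans (act_juxt f g _ y)

theorem act_juxt_pair {s t : Sign} {b c d : List Sign} (f : Diagram [s, t] b) (g : Diagram c d)
    (u : state X s) (v : state X t) (y : Elem X c) :
    act X (.juxt f g) (cons s (t :: c) u (cons t c v y)) =
      app b d (act X f (cons s [t] u (cons t [] v nil))) (act X g y) :=
  (congrArg _ (app_pair u v y).symm).trans (act_juxt f g _ y)

theorem act_juxt_triple {s t r : Sign} {b c d : List Sign} (f : Diagram [s, t, r] b)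
    (g : Diagram c d) (u : state X s) (v : state X t) (w : state X r) (y : Elem X c) :
    act X (.juxt f g) (cons s (t :: r :: c) u (cons t (r :: c) v (cons r c w y))) =
      app b d (act X f (cons s [t, r] u (cons t [r] v (cons r [] w nil)))) (act X g y) :=
  (congrArg _ (app_triple u v w y).symm).trans (act_juxt f g _ y)

theorem pointIso_hom_cons {s : Sign} (u : state X s) :
    (pointIso (state X) s).hom.hom (cons s [] u nil) = u := one_smul 𝔹.{u} u

theorem pairIso_hom_cons {s t : Sign} (u : state X s) (v : state X t) :
    (pairIso (state X) s t).hom.hom (cons s [t] u (cons t [] v nil)) = u ⊗ₜ[𝔹.{u}] v :=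
  congrArg (u ⊗ₜ[𝔹.{u}] ·) (one_smul 𝔹.{u} v)

theorem act_mul {s : Sign} (u v : state X s) :
    act X (.mul s) (cons s [s] u (cons s [] v nil)) = cons s [] (stateProd s u v) nil :=
  congrArg (fun t => (pointIso (state X) s).inv.hom ((stateMul X s).hom t)) (pairIso_hom_cons u v)

theorem act_comul {s : Sign} (u : state X s) :
    act X (.comul s) (cons s [] u nil) = ∑ x, 𝔹.truth.{u} (Mem s x u) •
      cons s [s] (nbhd s x) (cons s [] (nbhd s x) nil) := by
  refine (congrArg (fun t => (pairIso (state X) s s).inv.hom ((stateComul X s).hom t))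
    (pointIso_hom_cons u)).trans ?_
  refine (congrArg (pairIso (state X) s s).inv.hom (stateComul_apply s u)).trans ?_
  exact map_sum_truth_smul _ _ fun x => rfl

theorem act_counit {s : Sign} (u : state X s) :
    act X (.counit s) (cons s [] u nil) = 𝔹.truth.{u} (∃ x, Mem s x u) • nil := by
  refine (congrArg (stateCounit X s).hom (pointIso_hom_cons u)).trans ?_
  exact (stateCounit_apply s u).trans (mul_one (_ : 𝔹.{u})).symm

theorem act_cup : act X .cup nil =
    ∑ x, cons plus [minus] (nbhd plus x) (cons minus [] (nbhd minus x) nil) := by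
  refine (congrArg (pairIso (state X) plus minus).inv.hom stateCup_apply).trans ?_
  exact map_sum_of_eq _ fun x => rfl

theorem act_cap (v : state X minus) (u : state X plus) :
    act X .cap (cons minus [plus] v (cons plus [] u nil)) =
      𝔹.truth.{u} (∃ x, Mem minus x v ∧ Mem plus x u) • nil := by
  refine (congrArg (stateCap X).hom (pairIso_hom_cons v u)).trans ?_
  exact (mul_one (_ : 𝔹.{u})).symm

theorem act_cap' (u : state X plus) (v : state X minus) :
    act X .cap' (cons plus [minus] u (cons minus [] v nil)) =
      𝔹.truth.{u} (∃ x, Mem minus x v ∧ Mem plus x u) • nil :=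
  (congrArg (act X .cap) (act_braid_singleton u v)).trans (act_cap v u)

end Relations

/-! ### Verification of the one-foam relations -/

section FoamRelations

variable {X : Type u} [TopologicalSpace X] [Fintype X]

/-- If `y` lies in `V_x` and in `u`, then `x` lies in `U_y`, which is contained in `u`. Thus
evaluation against `V_x` is the functional "contains `x`". -/
theorem exists_mem_nbhd_minus_iff {x : X} {u : state X plus} :
    (∃ y, Mem minus y (nbhd minus x) ∧ Mem plus y u) ↔ Mem plus x u :=
  ⟨fun ⟨_, hy, hu⟩ => mem_of_mem_nbhd hu (mem_nbhd_minus_iff.1 hy),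
    fun h => ⟨x, mem_nbhd_self minus x, h⟩⟩

theorem exists_mem_nbhd_plus_iff {x : X} {v : state X minus} :
    (∃ y, Mem minus y v ∧ Mem plus y (nbhd plus x)) ↔ Mem minus x v :=
  ⟨fun ⟨_, hv, hy⟩ => mem_of_mem_nbhd hv (mem_nbhd_minus_iff.2 hy),
    fun h => ⟨x, h, mem_nbhd_self plus x⟩⟩

theorem app_smul_nil {s : Sign} {b : List Sign} (c : 𝔹.{u}) (u : state X s) (y : Elem X b) :
    app [s] b (c • cons s [] u nil) y = c • cons s b u y := by
  rw [map_smul, LinearMap.smul_apply, app_singleton]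

theorem sum_cons_nbhd {s : Sign} (a : List Sign) (u : state X s) (t : Elem X a) :
    ∑ x, 𝔹.truth.{u} (Mem s x u) • cons s a (nbhd s x) t = cons s a u t := by
  refine (map_sum_truth_smul ((cons s a).flip t) _ fun x => rfl).symm.trans ?_
  exact congrArg (fun v => cons s a v t) (sum_nbhd u)

/-- The composite sends `u` to the sum of the `U_x` weighted by the pairing of `V_x` with `u`, that
is, to the sum over the points of `u`. -/
theorem act_zigzag_plus (u : state X plus) :
    act X (.juxt (.idt [plus]) .cap) (act X (.juxt .cup (.idt [plus])) (cons plus [] u nil)) =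
      cons plus [] u nil := by
  have h₁ : act X (.juxt .cup (.idt [plus])) (cons plus [] u nil) =
      ∑ x, cons plus _ (nbhd plus x) (cons minus _ (nbhd minus x) (cons plus [] u nil)) := by
    refine (act_juxt_nil .cup (.idt [plus]) _).trans ?_
    rw [act_cup, act_idt]
    exact map_sum_of_eq ((app [plus, minus] [plus]).flip (cons plus [] u nil))
      fun x => app_pair _ _ _
  refine (congrArg _ h₁).trans ?_
  refine (map_sum_of_eq _ fun x => ?_).trans (sum_cons_nbhd [] u nil)
  refine (act_juxt_singleton (.idt [plus]) .cap _ _).trans ?_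
  rw [act_idt, act_cap, map_smul, exists_mem_nbhd_minus_iff]
  exact congrArg _ (app_singleton _ _)

theorem act_zigzag_minus (v : state X minus) :
    act X (.juxt .cap (.idt [minus])) (act X (.juxt (.idt [minus]) .cup) (cons minus [] v nil)) =
      cons minus [] v nil := by
  have h₁ : act X (.juxt (.idt [minus]) .cup) (cons minus [] v nil) =
      ∑ x, cons minus _ v (cons plus _ (nbhd plus x) (cons minus [] (nbhd minus x) nil)) := by
    refine (act_juxt_singleton (.idt [minus]) .cup v nil).trans ?_
    rw [act_cup, act_idt]
    exact map_sum_of_eq (app [minus] [plus, minus] _) fun x => app_singleton _ _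
  refine (congrArg _ h₁).trans ?_
  refine (map_sum_of_eq (act X (.juxt .cap (.idt [minus]))) fun x => ?_).trans
    (sum_cons_nbhd [] v nil)
  refine (act_juxt_pair .cap (.idt [minus]) _ _ _).trans ?_
  rw [act_idt, act_cap, map_smul, exists_mem_nbhd_plus_iff]
  exact congrArg _ (app_nil_left (cons minus [] (nbhd minus x) nil))

/-- Both sides test whether `u`, `u'` and `v` have a common point: on the right, each point `x` of
`v` contributes `V_x ⊗ V_x`, whose factors test `x` against `u'` and `u`. -/
theorem act_mul_dual (u u' : state X plus) (v : state X minus) :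
    act X .cap' (act X (.juxt (.mul plus) (.idt [minus]))
        (cons plus _ u (cons plus _ u' (cons minus [] v nil)))) =
      act X .cap' (act X (.juxt (.juxt (.idt [plus]) .cap') (.idt [minus]))
        (act X (.juxt (.idt [plus, plus]) (.comul minus))
          (cons plus _ u (cons plus _ u' (cons minus [] v nil))))) := by
  have h₁ : act X (.juxt (.mul plus) (.idt [minus]))
      (cons plus _ u (cons plus _ u' (cons minus [] v nil))) =
        cons plus [minus] (stateProd plus u u') (cons minus [] v nil) := by
    refine (act_juxt_pair (.mul plus) (.idt [minus]) _ _ _).trans ?_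
    rw [act_mul]
    exact app_singleton _ _
  have h₂ : act X (.juxt (.idt [plus, plus]) (.comul minus))
      (cons plus _ u (cons plus _ u' (cons minus [] v nil))) =
        ∑ x, 𝔹.truth.{u} (Mem minus x v) • cons plus _ u (cons plus _ u'
          (cons minus _ (nbhd minus x) (cons minus [] (nbhd minus x) nil))) := by
    refine (act_juxt_pair (.idt [plus, plus]) (.comul minus) _ _ _).trans ?_
    rw [act_comul]
    exact map_sum_truth_smul _ _ fun x => app_pair _ _ _
  have h₃ : ∀ x, act X (.juxt (.juxt (.idt [plus]) .cap') (.idt [minus]))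
      (cons plus _ u (cons plus _ u'
          (cons minus _ (nbhd minus x) (cons minus [] (nbhd minus x) nil)))) =
      𝔹.truth.{u} (Mem plus x u') • cons plus _ u (cons minus [] (nbhd minus x) nil) := fun x => by
    refine (act_juxt_triple (.juxt (.idt [plus]) .cap') (.idt [minus]) _ _ _ _).trans ?_
    have e : act X (.juxt (.idt [plus]) .cap') (cons plus _ u (cons plus _ u'
          (cons minus _ (nbhd minus x) nil))) =
        𝔹.truth.{u} (Mem plus x u') • cons plus [] u nil := by
      refine (act_juxt_singleton (.idt [plus]) .cap' _ _).trans ?_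
      rw [act_cap', map_smul, exists_mem_nbhd_minus_iff]
      exact congrArg _ (app_singleton _ _)
    exact (congrArg (fun t => app [plus] [minus] t _) e).trans (app_smul_nil _ _ _)
  refine ((congrArg _ h₁).trans (act_cap' _ _)).trans (Eq.symm ?_)
  refine (congrArg _ ((congrArg _ h₂).trans (map_sum_truth_smul _ _ h₃))).trans ?_
  -- With the existential expanded over points, the two sides agree summand by summand.
  rw [truth_exists_smul]
  refine (map_sum_truth_smul (act X .cap') _ fun x => (map_smul _ _ _).trans
    (congrArg _ (act_cap' _ _))).trans ?_
  refine Finset.sum_congr rfl fun x _ => ?_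
  rw [truth_smul_truth_smul, truth_smul_truth_smul, exists_mem_nbhd_minus_iff, mem_stateProd,
    and_comm (a := Mem plus x u), and_assoc]

theorem absorbs_cons {s : Sign} {a : List Sign} {u v : state X s} {x y : Elem X a}
    (h : Absorbs u v) (h' : Absorbs x y) : Absorbs (cons s a u x) (cons s a v y) :=
  h.map₂ h' (cons s a)

/-- One side is the sum of `U_y ⊗ U_y ⊗ V_x` over `y` in `U_x`, the other the sum of `U_x ⊗ U_y ⊗
(V_y ∩ V_x)` over all pairs. In both, every summand is absorbed by the diagonal ones `U_z ⊗ U_z ⊗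
V_z`. -/
theorem act_comul_dual :
    act X (.juxt (.comul plus) (.idt [minus])) (act X .cup nil) =
      act X (.juxt (.idt [plus, plus]) (.mul minus))
        (act X (.juxt (.juxt (.idt [plus]) .cup) (.idt [minus])) (act X .cup nil)) := by
  have h₁ : ∀ x, act X (.juxt (.comul plus) (.idt [minus]))
      (cons plus [minus] (nbhd plus x) (cons minus [] (nbhd minus x) nil)) =
      ∑ y, 𝔹.truth.{u} (Mem plus y (nbhd plus x)) •
        cons plus [plus, minus] (nbhd plus y)
          (cons plus [minus] (nbhd plus y) (cons minus [] (nbhd minus x) nil)) := fun x => by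
    refine (act_juxt_singleton (.comul plus) (.idt [minus]) _ _).trans ?_
    rw [act_comul]
    exact map_sum_truth_smul ((app [plus, plus] [minus]).flip (cons minus [] (nbhd minus x) nil)) _
      fun y => app_pair _ _ _
  have h₂ : ∀ x, act X (.juxt (.juxt (.idt [plus]) .cup) (.idt [minus]))
      (cons plus [minus] (nbhd plus x) (cons minus [] (nbhd minus x) nil)) =
      ∑ y, cons plus _ (nbhd plus x) (cons plus _ (nbhd plus y) (cons minus _ (nbhd minus y)
          (cons minus [] (nbhd minus x) nil))) := fun x => by
    refine (act_juxt_singleton (.juxt (.idt [plus]) .cup) (.idt [minus]) _ _).trans ?_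
    have e : act X (.juxt (.idt [plus]) .cup) (cons plus [] (nbhd plus x) nil) =
        ∑ y, cons plus [plus, minus] (nbhd plus x)
          (cons plus _ (nbhd plus y) (cons minus _ (nbhd minus y) nil)) := by
      refine (act_juxt_singleton (.idt [plus]) .cup _ _).trans ?_
      rw [act_cup]
      exact map_sum_of_eq _ fun y => app_singleton _ _
    refine (congrArg (fun t => app [plus, plus, minus] [minus] t
      (cons minus [] (nbhd minus x) nil)) e).trans ?_
    exact map_sum_of_eq ((app [plus, plus, minus] [minus]).flip
      (cons minus [] (nbhd minus x) nil)) fun y => app_triple _ _ _ _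
  have h₃ : ∀ x y, act X (.juxt (.idt [plus, plus]) (.mul minus))
      (cons plus _ (nbhd plus x) (cons plus _ (nbhd plus y) (cons minus _ (nbhd minus y)
          (cons minus [] (nbhd minus x) nil)))) =
      cons plus _ (nbhd plus x) (cons plus _ (nbhd plus y)
        (cons minus [] (stateProd minus (nbhd minus y) (nbhd minus x)) nil)) := fun x y => by
    refine (act_juxt_pair (.idt [plus, plus]) (.mul minus) _ _ _).trans ?_
    rw [act_mul]
    exact app_pair _ _ _
  rw [act_cup]
  refine (map_sum_of_eq _ h₁).trans (Eq.symm ?_)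
  refine (congrArg _ (map_sum_of_eq _ h₂)).trans ?_
  refine (map_sum_of_eq _ fun x => map_sum_of_eq _ (h₃ x)).trans ?_
  refine Absorbs.antisymm (Absorbs.sum fun x _ => Absorbs.sum fun y _ => ?_)
    (Absorbs.sum fun x _ => Absorbs.sum fun y _ => Absorbs.truth_smul fun hy => ?_)
  -- The intersection `V_y ∩ V_x` is split into the `V_z` it contains. For such `z` both `x` and `y`
  -- lie in `U_z`, so the term is absorbed by `U_z ⊗ U_z ⊗ V_z`, the summand with both indices `z`.
  · have e := sum_cons_nbhd [] (stateProd minus (nbhd minus y) (nbhd minus x)) nil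
    rw [← e, map_sum, map_sum]
    refine Absorbs.sum fun z _ => ?_
    rw [map_smul, map_smul]
    refine Absorbs.truth_smul fun hz => ?_
    have hz := mem_stateProd.1 hz
    have k := absorbs_sum.{u} (fun w : X => 𝔹.truth.{u} (Mem plus w (nbhd plus z)) •
        cons plus [plus, minus] (nbhd plus w)
          (cons plus [minus] (nbhd plus w) (cons minus [] (nbhd minus z) nil))) z
    rw [truth_smul_of (mem_nbhd_self plus z)] at k
    refine Absorbs.trans ?_ (k.trans (absorbs_sum.{u} (fun x : X => ∑ w : X,
      𝔹.truth.{u} (Mem plus w (nbhd plus x)) • cons plus [plus, minus] (nbhd plus w)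
          (cons plus [minus] (nbhd plus w) (cons minus [] (nbhd minus x) nil))) z))
    exact absorbs_cons (absorbs_nbhd (mem_nbhd_minus_iff.1 hz.2))
      (absorbs_cons (absorbs_nbhd (mem_nbhd_minus_iff.1 hz.1)) (Absorbs.refl.{u} _ _))
  -- Since `y` lies in `U_x`, the set `V_x` is contained in `V_y`, so the summand with both indices
  -- `y` absorbs the term.
  · have k := absorbs_sum.{u} (fun w : X => cons plus [plus, minus] (nbhd plus y)
      (cons plus [minus] (nbhd plus w)
        (cons minus [] (stateProd minus (nbhd minus w) (nbhd minus y)) nil))) y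
    refine Absorbs.trans ?_ (k.trans (absorbs_sum.{u} (fun x : X => ∑ w : X,
      cons plus [plus, minus] (nbhd plus x) (cons plus [minus] (nbhd plus w)
        (cons minus [] (stateProd minus (nbhd minus w) (nbhd minus x)) nil))) y))
    refine absorbs_cons (Absorbs.refl.{u} _ _) (absorbs_cons (Absorbs.refl.{u} _ _)
      (absorbs_cons (absorbs_of_mem fun z hz => mem_stateProd.2 ?_) (Absorbs.refl.{u} _ _)))
    have := mem_of_mem_nbhd (mem_nbhd_minus_iff.2 hy) hz
    exact ⟨this, this⟩

theorem act_unit_dual (v : state X minus) :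
    act X .cap' (act X (.juxt (.unit plus) (.idt [minus])) (cons minus [] v nil)) =
      act X (.counit minus) (cons minus [] v nil) := by
  have h : act X (.juxt (.unit plus) (.idt [minus])) (cons minus [] v nil) =
      cons plus [minus] (full X plus) (cons minus [] v nil) :=
    (act_juxt_nil (.unit plus) (.idt [minus]) _).trans (app_singleton _ _)
  refine (congrArg _ h).trans ((act_cap' _ _).trans ?_)
  rw [act_counit]
  simp only [mem_full, and_true]

theorem act_counit_dual (u : state X plus) :
    act X .cap' (act X (.juxt (.idt [plus]) (.unit minus)) (cons plus [] u nil)) =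
      act X (.counit plus) (cons plus [] u nil) := by
  have h : act X (.juxt (.idt [plus]) (.unit minus)) (cons plus [] u nil) =
      cons plus [minus] u (cons minus [] (full X minus) nil) :=
    (act_juxt_singleton (.idt [plus]) (.unit minus) u nil).trans (app_singleton _ _)
  refine (congrArg _ h).trans ((act_cap' _ _).trans ?_)
  rw [act_counit]
  simp only [mem_full, true_and]

theorem act_mul_assoc {s : Sign} (u v w : state X s) :
    act X (.mul s) (act X (.juxt (.mul s) (.idt [s]))
        (cons s _ u (cons s _ v (cons s [] w nil)))) =
      act X (.mul s) (act X (.juxt (.idt [s]) (.mul s))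
        (cons s _ u (cons s _ v (cons s [] w nil)))) := by
  have h₁ : act X (.juxt (.mul s) (.idt [s])) (cons s _ u (cons s _ v (cons s [] w nil))) =
      cons s [s] (stateProd s u v) (cons s [] w nil) := by
    refine (act_juxt_pair (.mul s) (.idt [s]) _ _ _).trans ?_
    rw [act_mul]
    exact app_singleton _ _
  have h₂ : act X (.juxt (.idt [s]) (.mul s)) (cons s _ u (cons s _ v (cons s [] w nil))) =
      cons s [s] u (cons s [] (stateProd s v w) nil) := by
    refine (act_juxt_singleton (.idt [s]) (.mul s) _ _).trans ?_
    rw [act_mul]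
    exact app_singleton _ _
  refine ((congrArg _ h₁).trans (act_mul _ _)).trans (((congrArg _ h₂).trans (act_mul _ _)).trans
    (congrArg (fun t => cons s [] t nil) (state_ext fun x => ?_))).symm
  simp only [mem_stateProd, and_assoc]

theorem act_mul_comm {s : Sign} (u v : state X s) :
    act X (.mul s) (act X (.braid [s] [s]) (cons s [s] u (cons s [] v nil))) =
      act X (.mul s) (cons s [s] u (cons s [] v nil)) := by
  rw [act_mul, ← show stateProd s v u = stateProd s u v from
    state_ext fun x => by simp only [mem_stateProd, and_comm]]
  exact (congrArg _ (act_braid_singleton u v)).trans (act_mul v u)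

theorem act_mul_unit {s : Sign} (u : state X s) :
    act X (.mul s) (act X (.juxt (.idt [s]) (.unit s)) (cons s [] u nil)) = cons s [] u nil := by
  have h : act X (.juxt (.idt [s]) (.unit s)) (cons s [] u nil) =
      cons s [s] u (cons s [] (full X s) nil) :=
    (act_juxt_singleton (.idt [s]) (.unit s) u nil).trans (app_singleton _ _)
  refine (congrArg _ h).trans ((act_mul _ _).trans
    (congrArg (fun t => cons s [] t nil) (state_ext fun x => ?_)))
  simp only [mem_stateProd, mem_full, and_true]

/-- The elements `U_x` are group-like: in `Δ(U_x)` the summands at other points of `U_x` are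
absorbed by `U_x ⊗ U_x`. Hence both sides are the sum of `U_x ⊗ U_x ⊗ U_x` over the points of `u`.
-/
theorem act_comul_assoc {s : Sign} (u : state X s) :
    act X (.juxt (.comul s) (.idt [s])) (act X (.comul s) (cons s [] u nil)) =
      act X (.juxt (.idt [s]) (.comul s)) (act X (.comul s) (cons s [] u nil)) := by
  rw [act_comul]
  have h₁ : ∀ x, act X (.juxt (.comul s) (.idt [s]))
      (cons s [s] (nbhd s x) (cons s [] (nbhd s x) nil)) =
        cons s [s, s] (nbhd s x) (cons s [s] (nbhd s x) (cons s [] (nbhd s x) nil)) := fun x => by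
    refine (act_juxt_singleton (.comul s) (.idt [s]) _ _).trans ?_
    rw [act_comul]
    refine (map_sum_truth_smul ((app [s, s] [s]).flip (cons s [] (nbhd s x) nil)) _
      fun y => app_pair _ _ _).trans ?_
    refine Absorbs.antisymm (Absorbs.sum fun y _ => Absorbs.truth_smul fun hy => ?_) ?_
    · exact absorbs_cons (absorbs_nbhd hy) (absorbs_cons (absorbs_nbhd hy) (Absorbs.refl.{u} _ _))
    · have k := absorbs_sum.{u} (fun y : X => 𝔹.truth.{u} (Mem s y (nbhd s x)) •
        cons s [s, s] (nbhd s y) (cons s [s] (nbhd s y) (cons s [] (nbhd s x) nil))) x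
      rwa [truth_smul_of (mem_nbhd_self s x)] at k
  have h₂ : ∀ x, act X (.juxt (.idt [s]) (.comul s))
      (cons s [s] (nbhd s x) (cons s [] (nbhd s x) nil)) =
        cons s [s, s] (nbhd s x) (cons s [s] (nbhd s x) (cons s [] (nbhd s x) nil)) := fun x => by
    refine (act_juxt_singleton (.idt [s]) (.comul s) _ _).trans ?_
    rw [act_comul]
    refine (map_sum_truth_smul _ _ fun y => app_singleton _ _).trans ?_
    refine Absorbs.antisymm (Absorbs.sum fun y _ => Absorbs.truth_smul fun hy => ?_) ?_
    · exact absorbs_cons (Absorbs.refl.{u} _ _)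
        (absorbs_cons (absorbs_nbhd hy) (absorbs_cons (absorbs_nbhd hy) (Absorbs.refl.{u} _ _)))
    · have k := absorbs_sum.{u} (fun y : X => 𝔹.truth.{u} (Mem s y (nbhd s x)) •
        cons s [s, s] (nbhd s x) (cons s [s] (nbhd s y) (cons s [] (nbhd s y) nil))) x
      rwa [truth_smul_of (mem_nbhd_self s x)] at k
  exact (map_sum_truth_smul _ _ h₁).trans (map_sum_truth_smul _ _ h₂).symm

theorem act_comul_comm {s : Sign} (u : state X s) :
    act X (.braid [s] [s]) (act X (.comul s) (cons s [] u nil)) =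
      act X (.comul s) (cons s [] u nil) := by
  rw [act_comul]
  exact map_sum_truth_smul (act X (.braid [s] [s])) _ fun x => act_braid_singleton _ _

/-- Each `U_x` is nonempty, so the counit removes one factor of `U_x ⊗ U_x` and the remaining sum is
`u`. -/
theorem act_comul_counit {s : Sign} (u : state X s) :
    act X (.juxt (.idt [s]) (.counit s)) (act X (.comul s) (cons s [] u nil)) =
      cons s [] u nil := by
  rw [act_comul]
  refine (map_sum_truth_smul _ _ fun x => ?_).trans (sum_cons_nbhd [] u nil)
  refine (act_juxt_singleton (.idt [s]) (.counit s) _ _).trans ?_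
  rw [act_counit, truth_smul_of ⟨x, mem_nbhd_self s x⟩]
  exact app_singleton _ _

theorem act_split_merge {s : Sign} (u : state X s) :
    act X (.mul s) (act X (.comul s) (cons s [] u nil)) = cons s [] u nil := by
  rw [act_comul]
  refine (map_sum_truth_smul _ _ fun x => (act_mul _ _).trans ?_).trans (sum_cons_nbhd [] u nil)
  exact congrArg (fun t => cons s [] t nil)
    (state_ext fun y => by simp only [mem_stateProd, and_self])

variable (X) in
-- The relations of the symmetric monoidal structure hold by coherence for any values of the
-- generators; the others are checked on pure tensors, the optional one included, so both versions
-- of the category are covered.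
theorem stateGenerators_eval_eq {sm : Prop} {a b : List Sign} {f g : Diagram a b}
    (h : Rel sm f g) : (stateGenerators X).eval f = (stateGenerators X).eval g := by
  induction h with
  | refl => rfl
  | symm _ ih => exact ih.symm
  | trans _ _ ih ih' => exact ih.trans ih'
  | comp_congr _ _ ih ih' => exact congrArg₂ (· ≫ ·) ih ih'
  | tensor_congr _ _ ih ih' => exact congrArg₂ juxtHom ih ih'
  | id_comp f => exact Category.id_comp _
  | comp_id f => exact Category.comp_id _
  | comp_assoc f g h => exact Category.assoc _ _ _
  | tensor_id a b => exact juxtHom_id a b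
  | tensor_comp f g f' g' => exact juxtHom_comp _ _ _ _
  | tensor_assoc f g h => exact juxtHom_assoc _ _ _
  | nil_tensor f =>
    exact (congrArg (· ≫ 𝟙 _) (nil_juxtHom _)).trans
      ((Category.comp_id _).trans (Category.id_comp _).symm)
  | tensor_nil f => exact juxtHom_nil _
  | braid_natural f g => exact braidHom_natural _ _
  | braid_symm a b => exact braidHom_symm a b
  | hexagon a b c => exact braidHom_hexagon a b c
  | zigzag_plus => exact hom_singleton_ext act_zigzag_plus
  | zigzag_minus => exact hom_singleton_ext act_zigzag_minus
  | mul_dual => exact hom_triple_ext act_mul_dual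
  | comul_dual => exact hom_nil_ext act_comul_dual
  | unit_dual => exact hom_singleton_ext act_unit_dual
  | counit_dual => exact hom_singleton_ext act_counit_dual
  | mul_assoc s => exact hom_triple_ext act_mul_assoc
  | mul_comm s => exact hom_pair_ext act_mul_comm
  | mul_unit s => exact hom_singleton_ext act_mul_unit
  | comul_assoc s => exact hom_singleton_ext act_comul_assoc
  | comul_comm s => exact hom_singleton_ext act_comul_comm
  | comul_counit s => exact hom_singleton_ext act_comul_counit
  | split_merge _ s => exact hom_singleton_ext act_split_merge

end FoamRelations

/-! ### Assembly of the functor of a finite space -/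

section FoamFunctor

variable (X : Type u) [TopologicalSpace X] [Fintype X]

/-- The foam functor of a finite space. -/
noncomputable def foamFunctor (sm : Prop) : FoamFunctor sm X where
  functor := (stateGenerators X).functor (sm := sm) (stateGenerators_eval_eq X)
  braided := (stateGenerators X).braided (stateGenerators_eval_eq X)
  ptIso s := pointIso (state X) s
  map_mul s := by
    change (appendPointIso (state X) s s).hom ≫ ((pairIso (state X) s s).hom ≫ stateMul X s ≫
      (pointIso (state X) s).inv) ≫ (pointIso (state X) s).hom =
        ((pointIso (state X) s).hom ⊗ₘ (pointIso (state X) s).hom) ≫ stateMul X s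
    -- The tensor product of the two `pointIso` factors through `pairIso`, with which the value of
    -- the vertex begins.
    rw [← appendPointIso_hom_comp]
    simp only [Category.assoc, Iso.inv_hom_id, Category.comp_id]
  map_comul s := by
    change ((pointIso (state X) s).hom ≫ stateComul X s ≫ (pairIso (state X) s s).inv) ≫
      (appendPointIso (state X) s s).inv ≫
        ((pointIso (state X) s).hom ⊗ₘ (pointIso (state X) s).hom) =
      (pointIso (state X) s).hom ≫ stateComul X s
    rw [appendPointIso_inv_comp]
    simp only [Category.assoc, Iso.inv_hom_id, Category.comp_id]
  map_unit s := by
    change 𝟙 (𝟙_ _) ≫ (stateUnit X s ≫ (pointIso (state X) s).inv) ≫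
      (pointIso (state X) s).hom = stateUnit X s
    simp only [Category.assoc, Category.id_comp, Iso.inv_hom_id, Category.comp_id]
  map_counit s := by
    change ((pointIso (state X) s).hom ≫ stateCounit X s) ≫ 𝟙 (𝟙_ _) =
      (pointIso (state X) s).hom ≫ stateCounit X s
    rw [Category.comp_id]
  map_cup := by
    change 𝟙 (𝟙_ _) ≫ (stateCup X ≫ (pairIso (state X) plus minus).inv) ≫
      (appendPointIso (state X) plus minus).inv ≫
        ((pointIso (state X) plus).hom ⊗ₘ (pointIso (state X) minus).hom) = stateCup X
    rw [appendPointIso_inv_comp]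
    simp only [Category.assoc, Category.id_comp, Iso.inv_hom_id, Category.comp_id]
  map_cap := by
    change (appendPointIso (state X) minus plus).hom ≫
      ((pairIso (state X) minus plus).hom ≫ stateCap X) ≫ 𝟙 (𝟙_ _) =
        ((pointIso (state X) minus).hom ⊗ₘ (pointIso (state X) plus).hom) ≫ stateCap X
    rw [← appendPointIso_hom_comp]
    simp only [Category.assoc, Category.comp_id]

end FoamFunctor

end OneFoam

theorem mainTheorem11 (sm : Prop) (X : Type u) [TopologicalSpace X] [Fintype X] :
    Nonempty (OneFoam.FoamFunctor sm X) ∧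
      (Nonempty X → ∀ (F : OneFoam.FoamFunctor sm X)
        (C : 𝟙_ (OneFoam.FCob sm) ⟶ 𝟙_ (OneFoam.FCob sm)), F.eval C = 1) := by
  exact ⟨⟨OneFoam.foamFunctor X sm⟩, fun _ F C => F.eval_eq_one C⟩
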